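/- **Theorem.** A *shape* $\lambda$ is a finite induced subgraph of the square grid on $\mathbb Z\times\mathbb Z$. A vertex $v$ of $\lambda$ is *interior* if $\lambda$ contains the $2\times 2$ grid (four unit squares, nine vertices) centered at $v$; the other vertices of $\lambda$ are *boundary* vertices. A *path* supported by $\lambda$ is a sequence $v_0,\dots,v_t$ of vertices of $\lambda$ such that $v_0,v_t$ are boundary vertices, $v_1,\dots,v_{t-1}$ are interior, and each $v_i$ with $i\ge 1$ is one step South or East of $v_{i-1}$. Say that paths $p_1,p_2$ *kiss along* a common subpath $p_1[v,v']=p_2[v,v']$, *with $p_1$ entering from the West*, if $p_1$ enters $v$ from the West and leaves $v'$ to the South while $p_2$ enters $v$ from the North and leaves $v'$ to the East. Two paths are *kissing* if, in one of the two orders, they kiss along some common subpath (possibly a single vertex). The *reduced non-kissing complex* of $\lambda$ has as faces the sets of pairwise non-kissing paths supported by $\lambda$ that are neither horizontal nor vertical; its *facets* are its maximal faces. Two facets $F_1,F_2$ are *adjacent* if $F_1\setminus F_2=\{p_1\}$ and $F_2\setminus F_1=\{p_2\}$ for some paths $p_1,p_2$; orient this edge of the dual graph as $F_1\to F_2$ if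 $p_1$ and $p_2$ kiss along a common subpath with $p_1$ entering from the West. Let $\mathrm{GT}(\lambda)$ be the set of facets with the relation $F\le G$ given by the reflexive and transitive closure of $\to$. Then, for every shape $\lambda$, $\mathrm{GT}(\lambda)$ is a partially ordered set, this poset is a (finite, nonempty) lattice, and this lattice is congruence-uniform. Here a finite lattice $L$ is *congruence-uniform* if $j\mapsto \mathrm{con}(j_*,j)$ is a bijection from the join-irreducible elements of $L$ to the join-irreducible elements of the lattice $\mathrm{Con}(L)$ of lattice congruences of $L$ ordered by refinement, and $m\mapsto\mathrm{con}(m,m^*)$ is a bijection from the meet-irreducible elements of $L$ to the join-irreducible elements of $\mathrm{Con}(L)$; $j_*$ is the unique element covered by $j$, $m^*$ is the unique element covering $m$, and $\mathrm{con}(x,y)$ is the smallest lattice congruence identifying $x$ and $y$. -/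

import Mathlib

/-! ### Shapes, paths, kissing -/

namespace GridTamari

/-- A shape: a finite induced subgraph of the square grid on `ℤ × ℤ`, given by its vertex set.
The first coordinate grows towards the East, the second one towards the North. -/
abbrev Shape := Finset (ℤ × ℤ)

/-- The neighbour to the East. -/
def east (v : ℤ × ℤ) : ℤ × ℤ := (v.1 + 1, v.2)

/-- The neighbour to the West. -/
def west (v : ℤ × ℤ) : ℤ × ℤ := (v.1 - 1, v.2)

/-- The neighbour to the North. -/
def north (v : ℤ × ℤ) : ℤ × ℤ := (v.1, v.2 + 1)

/-- The neighbour to the South. -/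
def south (v : ℤ × ℤ) : ℤ × ℤ := (v.1, v.2 - 1)

/-- `v` is an interior vertex of the shape: the shape contains the `2 × 2` grid (four unit squares,
nine vertices) centered at `v`. -/
def IsInterior (lam : Shape) (v : ℤ × ℤ) : Prop :=
  ∀ a ∈ Set.Icc (-1 : ℤ) 1, ∀ b ∈ Set.Icc (-1 : ℤ) 1, (v.1 + a, v.2 + b) ∈ lam

/-- A boundary vertex: a vertex of the shape that is not interior. -/
def IsBoundary (lam : Shape) (v : ℤ × ℤ) : Prop :=
  v ∈ lam ∧ ¬ IsInterior lam v

/-- `w` is one step South or East of `v`. -/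
def Step (v w : ℤ × ℤ) : Prop := w = south v ∨ w = east v

/-- A path supported by the shape: a sequence of vertices, each one step South or East of its
predecessor, whose first and last vertices are boundary vertices and all of whose other vertices
are interior. -/
structure IsPath (lam : Shape) (p : List (ℤ × ℤ)) : Prop where
  ne_nil : p ≠ []
  chain : p.IsChain Step
  head_boundary : IsBoundary lam (p.head ne_nil)
  last_boundary : IsBoundary lam (p.getLast ne_nil)
  interior : ∀ v ∈ p.tail.dropLast, IsInterior lam v

/-- A horizontal path: it stays in one row. -/
def IsHorizontal (p : List (ℤ × ℤ)) : Prop := ∀ v ∈ p, ∀ w ∈ p, v.2 = w.2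

/-- A vertical path: it stays in one column. -/
def IsVertical (p : List (ℤ × ℤ)) : Prop := ∀ v ∈ p, ∀ w ∈ p, v.1 = w.1

/-- `p` and `q` share the nonempty subpath `s`, say from `v` to `v'`, where `p` enters `v` from the
West and leaves `v'` to the South, and `q` enters `v` from the North and leaves `v'` to the East.
Here `l₁ <:+: l₂` says that `l₁` is a block of consecutive entries of `l₂`. -/
def KissAlong (p q s : List (ℤ × ℤ)) : Prop :=
  ∃ hs : s ≠ [],
    west (s.head hs) :: (s ++ [south (s.getLast hs)]) <:+: p ∧
    north (s.head hs) :: (s ++ [east (s.getLast hs)]) <:+: q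

/-- Two paths are kissing (an unordered relation). -/
def Kissing (p q : List (ℤ × ℤ)) : Prop :=
  (∃ s, KissAlong p q s) ∨ (∃ s, KissAlong q p s)

/-! ### The reduced non-kissing complex and the Grid-Tamari order -/

/-- The vertices of the reduced non-kissing complex: the paths supported by the shape which are
neither horizontal nor vertical. -/
def BentPath (lam : Shape) : Type :=
  {p : List (ℤ × ℤ) // IsPath lam p ∧ ¬ IsHorizontal p ∧ ¬ IsVertical p}

/-- The faces of the reduced non-kissing complex: sets of pairwise non-kissing paths (the empty
set is a face). -/
def IsFace (lam : Shape) (F : Set (BentPath lam)) : Prop :=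
  ∀ p ∈ F, ∀ q ∈ F, ¬ Kissing p.1 q.1

/-- The facets: the maximal faces. -/
def Facet (lam : Shape) : Type := {F : Set (BentPath lam) // Maximal (IsFace lam) F}

/-- The oriented dual graph: an edge `F₁ → F₂` if `F₁` and `F₂` are adjacent, that is, each one
arises from their intersection by adding a single path, say `p₁` for `F₁` and `p₂` for `F₂`, and
`p₁`, `p₂` kiss along a segment which `p₁` enters from the West and leaves to the South. -/
def DualEdge {lam : Shape} (F₁ F₂ : Facet lam) : Prop :=
  ∃ p₁ p₂ : BentPath lam, F₁.1 \ F₂.1 = {p₁} ∧ F₂.1 \ F₁.1 = {p₂} ∧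
    ∃ s, KissAlong p₁.1 p₂.1 s

/-- The relation of `GT(λ)`: the (reflexive and) transitive closure of the oriented dual graph. -/
def GTLe {lam : Shape} : Facet lam → Facet lam → Prop := Relation.ReflTransGen DualEdge

end GridTamari

/-! ### Lattice congruences and congruence-uniform lattices -/

namespace LatticeCon

variable {L : Type*} [Lattice L]

theorem ext_r {c d : LatticeCon L} (h : ∀ x y, c.r x y ↔ d.r x y) : c = d := by
  obtain ⟨c, _, _⟩ := c
  obtain ⟨d, _, _⟩ := d
  have : c = d := Setoid.ext h
  subst this
  rfl

/-- Congruences are ordered by refinement: the finer congruence is the smaller one. -/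
instance : PartialOrder (LatticeCon L) where
  le c d := ∀ x y, c.r x y → d.r x y
  le_refl _ _ _ h := h
  le_trans _ _ _ h₁ h₂ x y h := h₂ x y (h₁ x y h)
  le_antisymm _ _ h₁ h₂ := ext_r fun x y => ⟨h₁ x y, h₂ x y⟩

/-- The intersection of a set of congruences. -/
instance : InfSet (LatticeCon L) where
  sInf S :=
    { r := fun x y => ∀ c ∈ S, c.r x y
      iseqv := ⟨fun x d _ => d.refl x, fun h c hc => c.symm (h c hc),
        fun h₁ h₂ c hc => c.trans (h₁ c hc) (h₂ c hc)⟩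
      inf := fun h₁ h₂ c hc => c.inf (h₁ c hc) (h₂ c hc)
      sup := fun h₁ h₂ c hc => c.sup (h₁ c hc) (h₂ c hc) }

/-- The congruences of a lattice form a complete lattice under refinement. -/
instance : CompleteLattice (LatticeCon L) :=
  completeLatticeOfInf _ fun _ =>
    ⟨fun d hd _ _ h => h d hd, fun _ hb x y h _ hd => hb hd x y h⟩

/-- `con x y`: the smallest lattice congruence that identifies `x` and `y`. -/
def con (x y : L) : LatticeCon L := sInf {c | c.r x y}

end LatticeCon

open Classical in
/-- `j_*`: an element covered by `j` (the unique one if `j` is a join-irreducible element of a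
finite lattice; `j` itself if there is none). -/
noncomputable def lowerStar {L : Type*} [Lattice L] (j : L) : L :=
  if h : ∃ x, x ⋖ j then h.choose else j

open Classical in
/-- `m^*`: an element covering `m` (the unique one if `m` is a meet-irreducible element of a
finite lattice; `m` itself if there is none). -/
noncomputable def upperStar {L : Type*} [Lattice L] (m : L) : L :=
  if h : ∃ x, m ⋖ x then h.choose else m

/-- A (finite, nonempty) lattice `L` is congruence-uniform if `j ↦ con(j_*, j)` is a bijection from
the join-irreducibles of `L` to the join-irreducibles of the congruence lattice of `L`, and
`m ↦ con(m, m^*)` is a bijection from the meet-irreducibles of `L` to the same set. -/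
structure IsCongruenceUniform (L : Type*) [Lattice L] : Prop where
  finite : Finite L
  nonempty : Nonempty L
  join_bijOn : Set.BijOn (fun j : L => LatticeCon.con (lowerStar j) j)
    {j | SupIrred j} {c | SupIrred c}
  meet_bijOn : Set.BijOn (fun m : L => LatticeCon.con m (upperStar m))
    {m | InfIrred m} {c | SupIrred c}

/-!
A South-East walk meets each diagonal `x - y = d` at most once, so it is encoded by a function
`f : ℤ → ℤ`, the first coordinate of its vertex on the diagonal `d`, and an interval of diagonals.
A *segment* is a walk through interior vertices. A subsegment is a *piece of kind North* if it is
entered from the North or initial, and left to the East or final, and a *piece of kind West* if it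
is entered from the West or initial, and left to the South or final. A *torsion class* is a set of
segments closed under pieces of kind North and under concatenation. (The segments are the strings
of a gentle algebra, whose string modules are all bricks, and the torsion classes are those of its
module category.) The segments with no piece of kind West in a torsion class form a set of the same type
with the roles of the two kinds exchanged, and this is a duality (`IsTorsion.orth_orth`). All
statements are proved for both kinds at once, with the kind as a parameter `b : Bool`.

*The lattice.* Torsion classes form a lattice, whose joins are formed by concatenation. For a cover
`S ⋖ T` there is exactly one segment which lies in `T` and is torsion-free for `S`, its label
(`exists_isLabel_of_generated`). Agreement on a set of segments closed under subsegments is a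
lattice congruence (`restrictCon`); applied to the segments that do not contain a given label, it
shows that covers which generate the same congruence have the same label. As a join-irreducible or
meet-irreducible torsion class is determined by its label, the lattice is congruence-uniform.

*Facets.* A path is compatible with a torsion class `T` if `T` contains all segments that the path
enters from the North and leaves to the East, and none that it enters from the West and leaves to
the South. Compatible paths do not kiss. A compatible walk can always be extended by one
of the two possible steps until the boundary is reached (`Compatible.exists_fullWalk`). This yields
enough compatible paths to recover `T` from them and to show that they form a facet; and every
facet arises in this way. So facets correspond to torsion classes.

*Edges.* The facets of a cover `S ⋖ T` differ by an exchange of one path: a compatible path that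
is in only one of them contains the label, and two such paths cannot diverge
(`IsLabel.eq_of_inner`). Conversely, if adjacent facets had incomparable torsion classes, then one
and the same path would be exchanged both in a cover below and in a cover above one of them, which
is impossible (`IsLabel.not_inner_inner`). So the relation generated by the oriented edges is
inclusion of torsion classes.
-/

namespace GridTamari

/-! ### Walks, segments and their pieces -/

/-- A South-East walk is encoded by the function `f` which gives the first coordinate of its vertex
on each diagonal `d = x - y`; only the values on the relevant interval of diagonals matter.
`eastStep f d` says that the walk makes an East step (otherwise, a South step) from diagonal `d`
to diagonal `d + 1`. -/
def eastStep (f : ℤ → ℤ) (d : ℤ) : Bool := decide (f (d + 1) ≠ f d)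

/-- The part of `f` between the diagonals `i ≤ j` is a South-East walk through vertices
satisfying `I`, where `I x d` is about the vertex `(x, x - d)`. -/
def IsSegment (I : ℤ → ℤ → Prop) (i j : ℤ) (f : ℤ → ℤ) : Prop :=
  i ≤ j ∧ (∀ d, i ≤ d → d ≤ j → I (f d) d) ∧
    ∀ d, i ≤ d → d < j → f (d + 1) = f d ∨ f (d + 1) = f d + 1

/-- `[i', j']` is a piece of kind `b` of the segment `[i, j]` of `f`: it is entered by a step of
kind `b` unless it is initial, and left by a step of the other kind unless it is final. (In the
language of string modules, pieces of one kind are the quotients of the segment, and pieces of the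
other kind its submodules.) -/
def Piece (b : Bool) (f : ℤ → ℤ) (i j i' j' : ℤ) : Prop :=
  i ≤ i' ∧ i' ≤ j' ∧ j' ≤ j ∧ (i' = i ∨ eastStep f (i' - 1) = b) ∧ (j' = j ∨ eastStep f j' = !b)

theorem eastStep_congr {f g : ℤ → ℤ} {d : ℤ} (h : f d = g d) (h' : f (d + 1) = g (d + 1)) :
    eastStep f d = eastStep g d := by simp [eastStep, h, h']

theorem eastStep_sub_one_congr {f g : ℤ → ℤ} {d : ℤ} (h : f d = g d)
    (h' : f (d - 1) = g (d - 1)) : eastStep f (d - 1) = eastStep g (d - 1) :=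
  eastStep_congr h' (by simpa using h)

theorem IsSegment.congr {I : ℤ → ℤ → Prop} {i j : ℤ} {f g : ℤ → ℤ} (h : IsSegment I i j f)
    (hfg : ∀ d, i ≤ d → d ≤ j → f d = g d) : IsSegment I i j g := by
  refine ⟨h.1, fun d h1 h2 => hfg d h1 h2 ▸ h.2.1 d h1 h2, fun d h1 h2 => ?_⟩
  rw [← hfg d h1 h2.le, ← hfg (d + 1) (by omega) (by omega)]
  exact h.2.2 d h1 h2

theorem IsSegment.mono {I : ℤ → ℤ → Prop} {i j i' j' : ℤ} {f : ℤ → ℤ} (h : IsSegment I i j f)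
    (h1 : i ≤ i') (h2 : i' ≤ j') (h3 : j' ≤ j) : IsSegment I i' j' f :=
  ⟨h2, fun d _ _ => h.2.1 d (by omega) (by omega), fun d _ _ => h.2.2 d (by omega) (by omega)⟩

theorem Piece.congr {b : Bool} {f g : ℤ → ℤ} {i j i' j' : ℤ} (h : Piece b f i j i' j')
    (hfg : ∀ d, i ≤ d → d ≤ j → f d = g d) : Piece b g i j i' j' := by
  obtain ⟨h1, h2, h3, h4, h5⟩ := h
  refine ⟨h1, h2, h3, ?_, ?_⟩
  · by_cases hi : i' = i
    · exact .inl hi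
    · rw [← eastStep_sub_one_congr (hfg i' h1 (by omega)) (hfg _ (by omega) (by omega))]
      exact h4
  · by_cases hj : j' = j
    · exact .inl hj
    · rw [← eastStep_congr (hfg j' (by omega) h3) (hfg _ (by omega) (by omega))]
      exact h5

theorem Piece.refl {b : Bool} {f : ℤ → ℤ} {i j : ℤ} (h : i ≤ j) : Piece b f i j i j :=
  ⟨le_rfl, h, le_rfl, .inl rfl, .inl rfl⟩

theorem Piece.trans {b : Bool} {f : ℤ → ℤ} {i j i' j' i'' j'' : ℤ} (h : Piece b f i j i' j')
    (h' : Piece b f i' j' i'' j'') : Piece b f i j i'' j'' := by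
  obtain ⟨h1, h2, h3, h4, h5⟩ := h
  obtain ⟨k1, k2, k3, k4, k5⟩ := h'
  refine ⟨by omega, k2, by omega, ?_, ?_⟩
  · rcases k4 with rfl | k4
    · exact h4
    · exact .inr k4
  · rcases k5 with rfl | k5
    · exact h5
    · exact .inr k5

/-! ### Torsion classes of segments -/

/-- A torsion class of kind `b`: a set of segments (`T i j f` depends only on the values of `f`
between `i` and `j`) closed under pieces of kind `b` and under concatenation. -/
structure IsTorsion (I : ℤ → ℤ → Prop) (b : Bool) (T : ℤ → ℤ → (ℤ → ℤ) → Prop) : Prop where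
  seg : ∀ {i j f}, T i j f → IsSegment I i j f
  congr : ∀ {i j f g}, T i j f → (∀ d, i ≤ d → d ≤ j → f d = g d) → T i j g
  sub : ∀ {i j f i' j'}, T i j f → Piece b f i j i' j' → T i' j' f
  cat : ∀ {i j k f}, IsSegment I i k f → T i j f → T (j + 1) k f → T i k f

/-- The segments without a piece of kind `!b` in `T`; for a torsion class `T` of kind `b` this is
the corresponding torsion-free class, which is a torsion class of kind `!b`. -/
def orth (I : ℤ → ℤ → Prop) (b : Bool) (T : ℤ → ℤ → (ℤ → ℤ) → Prop) (i j : ℤ) (f : ℤ → ℤ) : Prop :=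
  IsSegment I i j f ∧ ∀ i' j', Piece (!b) f i j i' j' → ¬ T i' j' f

variable {I : ℤ → ℤ → Prop} {b : Bool} {T : ℤ → ℤ → (ℤ → ℤ) → Prop}

theorem orth.not_mem {i j : ℤ} {f : ℤ → ℤ} (h : orth I b T i j f) : ¬ T i j f :=
  h.2 i j (Piece.refl h.1.1)

theorem orth.anti {T' : ℤ → ℤ → (ℤ → ℤ) → Prop} (hT : ∀ i j f, T' i j f → T i j f) {i j : ℤ}
    {f : ℤ → ℤ} (h : orth I b T i j f) : orth I b T' i j f :=
  ⟨h.1, fun _ _ hp ht => h.2 _ _ hp (hT _ _ _ ht)⟩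

theorem bool_eq_or_eq_not (a b : Bool) : a = b ∨ a = !b := by cases a <;> cases b <;> simp

theorem bool_ne_not {a b : Bool} (h : a = b) (h' : a = !b) : False := by
  subst h
  revert h'
  cases a <;> decide

theorem IsTorsion.isTorsion_orth (hT : IsTorsion I b T) : IsTorsion I (!b) (orth I b T) where
  seg h := h.1
  congr {i j f g} h hfg := by
    refine ⟨h.1.congr hfg, fun i' j' hp ht => ?_⟩
    have hgf : ∀ d, i ≤ d → d ≤ j → g d = f d := fun d h1 h2 => (hfg d h1 h2).symm
    refine h.2 i' j' (hp.congr hgf) (hT.congr ht fun d h1 h2 => hgf d ?_ ?_)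
    · exact hp.1.trans h1
    · exact h2.trans hp.2.2.1
  sub h hp := ⟨h.1.mono hp.1 hp.2.1 hp.2.2.1, fun i'' j'' hp' => h.2 _ _ (hp.trans hp')⟩
  cat {i j k f} hs h h' := by
    refine ⟨hs, fun i' j' hp ht => ?_⟩
    obtain ⟨h1, h2, h3, h4, h5⟩ := hp
    have hij := h.1.1
    have hjk := h'.1.1
    rcases lt_or_ge j i' with hi | hi
    · exact h'.2 i' j' ⟨by omega, h2, h3, h4.imp (by omega) id, h5⟩ ht
    rcases lt_or_ge j j' with hj | hj
    · rcases bool_eq_or_eq_not (eastStep f j) b with e | e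
      · refine h'.2 (j + 1) j' ⟨le_rfl, by omega, h3, .inl rfl, h5⟩
          (hT.sub ht ⟨by omega, by omega, le_rfl, .inr (by simpa using e), .inl rfl⟩)
      · refine h.2 i' j ⟨h1, hi, le_rfl, h4, .inl rfl⟩
          (hT.sub ht ⟨le_rfl, hi, by omega, .inl rfl, .inr e⟩)
    · exact h.2 i' j' ⟨h1, h2, hj, h4, (eq_or_ne j' j).imp id fun hne =>
        h5.resolve_left (by omega)⟩ ht

/-- A shortest piece of kind `b` outside of a torsion class `T` of kind `b` is torsion-free: if it
had a piece of the other kind in `T`, then it would be a concatenation of elements of `T`. -/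
theorem IsTorsion.exists_piece_orth (hT : IsTorsion I b T) {i j : ℤ} {f : ℤ → ℤ}
    (hs : IsSegment I i j f) (h : ¬ T i j f) :
    ∃ i' j', Piece b f i j i' j' ∧ orth I b T i' j' f ∧
      ∀ i'' j'', Piece b f i' j' i'' j'' → (i' < i'' ∨ j'' < j') → T i'' j'' f := by
  induction hn : (j - i).toNat using Nat.strong_induction_on generalizing i j with
  | _ n ih =>
  subst hn
  by_cases hp : ∃ i' j', Piece b f i j i' j' ∧ (i < i' ∨ j' < j) ∧ ¬ T i' j' f
  · obtain ⟨i', j', hp, hlt, ht⟩ := hp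
    obtain ⟨i'', j'', hp', ho⟩ := ih _ (by have := hp.1; have := hp.2.1; have := hp.2.2.1; omega)
      (hs.mono hp.1 hp.2.1 hp.2.2.1) ht rfl
    exact ⟨i'', j'', hp.trans hp', ho⟩
  · push Not at hp
    refine ⟨i, j, Piece.refl hs.1, ⟨hs, fun i' j' hq ht => h ?_⟩, hp⟩
    obtain ⟨h1, h2, h3, h4, h5⟩ := hq
    -- glue `[i', j']` to what is left of it, then to what is right of it
    have hl : T i j' f := by
      rcases h1.eq_or_lt with rfl | hlt
      · exact ht
      · refine hT.cat (hs.mono le_rfl (by omega) h3) (j := i' - 1) ?_ (by simpa using ht)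
        exact hp i (i' - 1) ⟨le_rfl, by omega, by omega, .inl rfl,
          .inr (h4.resolve_left (by omega))⟩ (.inr (by omega))
    rcases h3.eq_or_lt with rfl | hlt
    · exact hl
    · refine hT.cat hs hl (hp (j' + 1) j ⟨by omega, by omega, le_rfl, ?_, .inl rfl⟩
        (.inl (by omega)))
      exact .inr (by simpa using h5.resolve_left (by omega))

theorem IsTorsion.orth_orth (hT : IsTorsion I b T) {i j : ℤ} {f : ℤ → ℤ} :
    orth I (!b) (orth I b T) i j f ↔ T i j f := by
  constructor
  · intro h
    by_contra ht
    obtain ⟨i', j', hp, ho, -⟩ := hT.exists_piece_orth h.1 ht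
    exact h.2 i' j' (by simpa using hp) ho
  · intro h
    exact ⟨hT.seg h, fun i' j' hp ho => ho.not_mem (hT.sub h (by simpa using hp))⟩

/-! ### Joins of torsion classes -/

/-- The segments that are concatenations of elements of `U`. -/
inductive Filt (I : ℤ → ℤ → Prop) (U : ℤ → ℤ → (ℤ → ℤ) → Prop) : ℤ → ℤ → (ℤ → ℤ) → Prop
  | base {i j f} : U i j f → Filt I U i j f
  | cat {i j k f} : IsSegment I i k f → Filt I U i j f → Filt I U (j + 1) k f → Filt I U i k f

variable {U : ℤ → ℤ → (ℤ → ℤ) → Prop}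

theorem isTorsion_filt (hseg : ∀ {i j f}, U i j f → IsSegment I i j f)
    (hcongr : ∀ {i j f g}, U i j f → (∀ d, i ≤ d → d ≤ j → f d = g d) → U i j g)
    (hsub : ∀ {i j f i' j'}, U i j f → Piece b f i j i' j' → U i' j' f) :
    IsTorsion I b (Filt I U) := by
  have hs : ∀ {i j f}, Filt I U i j f → IsSegment I i j f := by
    intro i j f h
    cases h with
    | base h => exact hseg h
    | cat h _ _ => exact h
  refine ⟨hs, ?_, ?_, .cat⟩
  · intro i j f g h
    induction h generalizing g with
    | base h => exact fun hfg => .base (hcongr h hfg)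
    | cat hik h h' ih ih' =>
      intro hfg
      have := (hs h).1
      have := (hs h').1
      exact .cat (hik.congr hfg) (ih fun d _ _ => hfg d (by omega) (by omega))
        (ih' fun d _ _ => hfg d (by omega) (by omega))
  · intro i j f i' j' h
    induction h generalizing i' j' with
    | base h => exact fun hp => .base (hsub h hp)
    | @cat i j k f hik h h' ih ih' =>
      rintro ⟨h1, h2, h3, h4, h5⟩
      have := (hs h).1
      have := (hs h').1
      rcases lt_or_ge j i' with hi | hi
      · exact ih' ⟨by omega, h2, h3, h4.imp (by omega) id, h5⟩
      rcases lt_or_ge j j' with hj | hj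
      · rcases bool_eq_or_eq_not (eastStep f j) b with e | e
        all_goals
          refine .cat (hik.mono h1 h2 h3) (ih ⟨h1, hi, le_rfl, h4, .inl rfl⟩)
            (ih' ⟨le_rfl, by omega, h3, .inl rfl, h5⟩)
      · exact ih ⟨h1, h2, hj, h4, (eq_or_ne j' j).imp id fun hne => h5.resolve_left (by omega)⟩

theorem Filt.mem_of_subset (hT : IsTorsion I b T) (hU : ∀ i j f, U i j f → T i j f) {i j : ℤ}
    {f : ℤ → ℤ} (h : Filt I U i j f) : T i j f := by
  induction h with
  | base h => exact hU _ _ _ h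
  | cat h _ _ ih ih' => exact hT.cat h ih ih'

/-- One of the factors of a concatenation is a piece of kind `b`. -/
theorem Filt.exists_piece (hU : ∀ i j f, U i j f → i ≤ j) (b : Bool) {i j : ℤ} {f : ℤ → ℤ}
    (h : Filt I U i j f) : ∃ i' j', Piece b f i j i' j' ∧ U i' j' f := by
  induction h with
  | base h => exact ⟨_, _, Piece.refl (hU _ _ _ h), h⟩
  | @cat i j k f _ _ _ ih ih' =>
    obtain ⟨i₁, j₁, hp₁, hu₁⟩ := ih
    obtain ⟨i₂, j₂, hp₂, hu₂⟩ := ih'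
    have := hp₁.1.trans (hp₁.2.1.trans hp₁.2.2.1)
    have := hp₂.1.trans (hp₂.2.1.trans hp₂.2.2.1)
    rcases bool_eq_or_eq_not (eastStep f j) b with e | e
    · exact ⟨i₂, j₂, Piece.trans ⟨by omega, by omega, le_rfl, .inr (by simpa using e), .inl rfl⟩ hp₂,
        hu₂⟩
    · exact ⟨i₁, j₁, Piece.trans ⟨le_rfl, by omega, by omega, .inl rfl, .inr e⟩ hp₁, hu₁⟩

/-! ### The segment that labels a cover of torsion classes -/

/-- `(a, c, s)` is, up to the values of `s` outside of `[a, c]`, the only segment which lies in the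
torsion class `T` and is torsion-free with respect to `T'`. -/
structure IsLabel (I : ℤ → ℤ → Prop) (b : Bool) (T' T : ℤ → ℤ → (ℤ → ℤ) → Prop) (a c : ℤ)
    (s : ℤ → ℤ) : Prop where
  mem : T a c s
  mem_orth : orth I b T' a c s
  unique : ∀ {i j f}, T i j f → orth I b T' i j f →
    i = a ∧ j = c ∧ ∀ d, a ≤ d → d ≤ c → f d = s d

variable {T' : ℤ → ℤ → (ℤ → ℤ) → Prop}

theorem IsLabel.dual (hT : IsTorsion I b T) {a c : ℤ} {s : ℤ → ℤ} (h : IsLabel I b T' T a c s) :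
    IsLabel I (!b) (orth I b T) (orth I b T') a c s :=
  ⟨h.mem_orth, hT.orth_orth.2 h.mem, fun h1 h2 => h.unique (hT.orth_orth.1 h2) h1⟩

/-- If `s` is a shortest segment in `T` that is torsion-free for `T'`, and `s` and `T'` generate
`T`, then all segments in `T` that are torsion-free for `T'` have `s` as a piece. -/
theorem exists_piece_of_generated (hT : IsTorsion I b T) (hT' : IsTorsion I b T')
    (hle : ∀ i j f, T' i j f → T i j f) {a c : ℤ} {s : ℤ → ℤ} (hs : T a c s)
    (hmin : ∀ i j f, T i j f → orth I b T' i j f → c - a ≤ j - i)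
    (hgen : ∀ Y, IsTorsion I b Y → (∀ i j f, T' i j f → Y i j f) → (∀ i j f, Y i j f → T i j f) →
      Y a c s → ∀ i j f, T i j f → Y i j f)
    {i j : ℤ} {f : ℤ → ℤ} (hf : T i j f) (hf' : orth I b T' i j f) :
    Piece (!b) f i j a c ∧ ∀ d, a ≤ d → d ≤ c → f d = s d := by
  let U : ℤ → ℤ → (ℤ → ℤ) → Prop := fun i j f => T' i j f ∨
    (Piece b s a c i j ∧ ∀ d, i ≤ d → d ≤ j → f d = s d)
  have hUT : ∀ i j f, U i j f → T i j f := by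
    rintro i j f (h | ⟨hp, hfs⟩)
    · exact hle _ _ _ h
    · exact hT.congr (hT.sub hs hp) fun d h1 h2 => (hfs d h1 h2).symm
  have hY : IsTorsion I b (Filt I U) := by
    refine isTorsion_filt (fun h => hT.seg (hUT _ _ _ h)) ?_ ?_
    · rintro i j f g (h | ⟨hp, hfs⟩) hfg
      · exact .inl (hT'.congr h hfg)
      · exact .inr ⟨hp, fun d h1 h2 => (hfg d h1 h2).symm.trans (hfs d h1 h2)⟩
    · rintro i j f i' j' (h | ⟨hp, hfs⟩) hq
      · exact .inl (hT'.sub h hq)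
      · refine .inr ⟨hp.trans (hq.congr hfs), fun d h1 h2 => hfs d ?_ ?_⟩
        · exact hq.1.trans h1
        · exact h2.trans hq.2.2.1
  have hmem := hgen _ hY (fun _ _ _ h => .base (.inl h))
    (fun _ _ _ h => h.mem_of_subset hT hUT)
    (.base (.inr ⟨Piece.refl (hT.seg hs).1, fun _ _ _ => rfl⟩)) i j f hf
  obtain ⟨i', j', hp, hu⟩ := hmem.exists_piece (fun _ _ _ h => (hT.seg (hUT _ _ _ h)).1) (!b)
  have ho := hT'.isTorsion_orth.sub hf' hp
  rcases hu with hu | ⟨hq, hfs⟩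
  · exact (ho.not_mem hu).elim
  have hl := hmin _ _ _ (hT.congr (hT.sub hs hq) fun d h1 h2 => (hfs d h1 h2).symm) ho
  obtain ⟨h1, h2, h3, -, -⟩ := hq
  obtain rfl : i' = a := by omega
  obtain rfl : j' = c := by omega
  exact ⟨hp, hfs⟩

theorem exists_isLabel_of_generated (hT : IsTorsion I b T) (hT' : IsTorsion I b T')
    (hle : ∀ i j f, T' i j f → T i j f) (hne : ∃ i j f, T i j f ∧ ¬ T' i j f)
    (hcov : ∀ Y, IsTorsion I b Y → (∀ i j f, T' i j f → Y i j f) →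
      (∀ i j f, Y i j f → T i j f) → (∃ i j f, Y i j f ∧ ¬ T' i j f) →
        ∀ i j f, T i j f → Y i j f) :
    ∃ a c s, IsLabel I b T' T a c s := by
  have hne' : ∃ n : ℕ, ∃ i j f, T i j f ∧ orth I b T' i j f ∧ (j - i).toNat = n := by
    obtain ⟨i, j, f, h, h'⟩ := hne
    obtain ⟨i', j', hp, ho, -⟩ := hT'.exists_piece_orth (hT.seg h) h'
    exact ⟨_, i', j', f, hT.sub h hp, ho, rfl⟩
  classical
  obtain ⟨a, c, s, hs, hs', hn⟩ := Nat.find_spec hne'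
  have hmin : ∀ i j f, T i j f → orth I b T' i j f → c - a ≤ j - i := by
    intro i j f h h'
    have := Nat.find_min' hne' ⟨i, j, f, h, h', rfl⟩
    have := (hT.seg h).1
    have := (hT.seg hs).1
    omega
  refine ⟨a, c, s, hs, hs', fun {i j f} hf hf' => ?_⟩
  obtain ⟨p1, hfs⟩ := exists_piece_of_generated hT hT' hle hs hmin
    (fun Y hY h1 h2 h3 => hcov Y hY h1 h2 ⟨a, c, s, h3, hs'.not_mem⟩) hf hf'
  -- the dual statement, for the torsion-free classes
  obtain ⟨p2, -⟩ := exists_piece_of_generated (T := orth I b T') (T' := orth I b T) hT'.isTorsion_orth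
    hT.isTorsion_orth
    (fun i j f h => h.anti hle) hs'
    (fun i j f h h' => hmin i j f (hT.orth_orth.1 h') h) (by
      intro Y hY h1 h2 h3 i j f hf
      have hY' : IsTorsion I b (orth I (!b) Y) := by simpa using hY.isTorsion_orth
      have hY'' := hY.orth_orth (i := i) (j := j) (f := f)
      rw [Bool.not_not] at hY''
      by_contra hc
      rw [← hY''] at hc
      have key : ∀ i j f, orth I (!b) Y i j f → T' i j f := by
        by_contra hex
        push Not at hex
        have := hcov _ hY' (fun i j f h => (hT'.orth_orth.2 h).anti h2)
          (fun i j f h => hT.orth_orth.1 (h.anti h1)) hex a c s hs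
        exact this.not_mem h3
      exact hc (hf.anti key)) hf' (hT.orth_orth.2 hf)
  rw [Bool.not_not] at p2
  obtain ⟨h1, h2, h3, h4, h5⟩ := p1
  obtain ⟨-, -, -, h4', h5'⟩ := p2
  refine ⟨?_, ?_, hfs⟩
  · by_contra hia
    exact bool_ne_not (h4'.resolve_left (Ne.symm hia)) (h4.resolve_left (Ne.symm hia))
  · by_contra hjc
    exact bool_ne_not (h5'.resolve_left (Ne.symm hjc)) (h5.resolve_left (Ne.symm hjc))

/-! ### Walks that are compatible with a torsion class -/

/-- `f` is a South-East walk from the diagonal `lo` to the diagonal `hi`, with at least one vertex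
strictly in between, all of whose intermediate vertices satisfy `I`. -/
def IsWalk (I : ℤ → ℤ → Prop) (lo hi : ℤ) (f : ℤ → ℤ) : Prop :=
  lo + 1 < hi ∧ (∀ d, lo < d → d < hi → I (f d) d) ∧
    ∀ d, lo ≤ d → d < hi → f (d + 1) = f d ∨ f (d + 1) = f d + 1

/-- A walk both of whose ends violate `I`, that is, a path between boundary vertices. -/
def IsFullWalk (I : ℤ → ℤ → Prop) (lo hi : ℤ) (f : ℤ → ℤ) : Prop :=
  IsWalk I lo hi f ∧ ¬ I (f lo) lo ∧ ¬ I (f hi) hi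

/-- `[i, j]` is a segment in the inside of the walk `f` from `lo` to `hi` which is entered by a step
of kind `b` and left by a step of the other kind. -/
def Inner (b : Bool) (f : ℤ → ℤ) (lo hi i j : ℤ) : Prop :=
  lo < i ∧ i ≤ j ∧ j < hi ∧ eastStep f (i - 1) = b ∧ eastStep f j = !b

/-- The inner segments of kind `b` of the walk lie in `T`, those of the other kind do not. -/
def Compatible (b : Bool) (T : ℤ → ℤ → (ℤ → ℤ) → Prop) (lo hi : ℤ) (f : ℤ → ℤ) : Prop :=
  (∀ i j, Inner b f lo hi i j → T i j f) ∧ ∀ i j, Inner (!b) f lo hi i j → ¬ T i j f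

theorem IsWalk.isSegment {lo hi i j : ℤ} {f : ℤ → ℤ} (h : IsWalk I lo hi f) (h1 : lo < i)
    (h2 : i ≤ j) (h3 : j < hi) : IsSegment I i j f :=
  ⟨h2, fun d _ _ => h.2.1 d (by omega) (by omega), fun d _ _ => h.2.2 d (by omega) (by omega)⟩

theorem Inner.piece {lo hi i j i' j' : ℤ} {f : ℤ → ℤ} (h : Inner b f lo hi i j)
    (hp : Piece b f i j i' j') : Inner b f lo hi i' j' := by
  obtain ⟨h1, h2, h3, h4, h5⟩ := h
  obtain ⟨k1, k2, k3, k4, k5⟩ := hp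
  refine ⟨by omega, k2, by omega, ?_, ?_⟩
  · rcases k4 with rfl | k4 <;> assumption
  · rcases k5 with rfl | k5 <;> assumption

theorem Inner.congr {lo hi i j lo' hi' : ℤ} {f g : ℤ → ℤ} (h : Inner b f lo hi i j)
    (hlo : lo' < i) (hhi : j < hi') (hfg : ∀ d, i - 1 ≤ d → d ≤ j + 1 → f d = g d) :
    Inner b g lo' hi' i j := by
  obtain ⟨h1, h2, h3, h4, h5⟩ := h
  refine ⟨hlo, h2, hhi, ?_, ?_⟩
  · rw [← eastStep_sub_one_congr (hfg i (by omega) (by omega)) (hfg _ le_rfl (by omega)), h4]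
  · rw [← eastStep_congr (hfg j (by omega) (by omega)) (hfg _ (by omega) le_rfl), h5]

theorem Compatible.orth_of_inner {lo hi i j : ℤ} {f : ℤ → ℤ} (hw : IsWalk I lo hi f)
    (h : Compatible b T lo hi f) (hi : Inner (!b) f lo hi i j) : orth I b T i j f :=
  ⟨hw.isSegment hi.1 hi.2.1 hi.2.2.1, fun _ _ hp => h.2 _ _ (hi.piece hp)⟩

theorem Compatible.dual {lo hi : ℤ} {f : ℤ → ℤ} (hw : IsWalk I lo hi f)
    (h : Compatible b T lo hi f) : Compatible (!b) (orth I b T) lo hi f :=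
  ⟨fun _ _ hi => h.orth_of_inner hw hi, fun _ _ hi ho =>
    ho.not_mem (h.1 _ _ (by simpa using hi))⟩

theorem Compatible.of_dual (hT : IsTorsion I b T) {lo hi : ℤ} {f : ℤ → ℤ} (hw : IsWalk I lo hi f)
    (h : Compatible (!b) (orth I b T) lo hi f) : Compatible b T lo hi f :=
  ⟨fun _ _ hi => hT.orth_orth.1 (h.orth_of_inner hw (by simpa using hi)),
    fun _ _ hi => (h.1 _ _ hi).not_mem⟩

theorem Compatible.congr (hT : IsTorsion I b T) {lo hi : ℤ} {f g : ℤ → ℤ}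
    (h : Compatible b T lo hi f) (hfg : ∀ d, lo ≤ d → d ≤ hi → f d = g d) :
    Compatible b T lo hi g := by
  have hgf : ∀ {i j : ℤ}, lo < i → j < hi → ∀ d, i - 1 ≤ d → d ≤ j + 1 → g d = f d :=
    fun _ _ d _ _ => (hfg d (by omega) (by omega)).symm
  refine ⟨fun i j hi => ?_, fun i j hi ht => ?_⟩
  · have := hgf hi.1 hi.2.2.1
    exact hT.congr (h.1 i j (hi.congr hi.1 hi.2.2.1 this))
      fun d _ _ => (this d (by omega) (by omega)).symm
  · have := hgf hi.1 hi.2.2.1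
    exact h.2 i j (hi.congr hi.1 hi.2.2.1 this)
      (hT.congr ht fun d _ _ => this d (by omega) (by omega))

/-! ### Extending compatible walks to the boundary -/

/-- `f` up to the diagonal `n`, followed by an East step if `c` holds, and by a South step if not. -/
def extendRight (f : ℤ → ℤ) (n : ℤ) (c : Bool) (d : ℤ) : ℤ :=
  if d ≤ n then f d else f n + (if c then 1 else 0)

/-- `f` from the diagonal `n` on, preceded by an East step if `c` holds, and by a South step if
not. -/
def extendLeft (f : ℤ → ℤ) (n : ℤ) (c : Bool) (d : ℤ) : ℤ :=
  if n ≤ d then f d else f n - (if c then 1 else 0)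

theorem extendRight_of_le {f : ℤ → ℤ} {n : ℤ} {c : Bool} {d : ℤ} (h : d ≤ n) :
    extendRight f n c d = f d := if_pos h

theorem extendLeft_of_le {f : ℤ → ℤ} {n : ℤ} {c : Bool} {d : ℤ} (h : n ≤ d) :
    extendLeft f n c d = f d := if_pos h

theorem eastStep_extendRight {f : ℤ → ℤ} {n : ℤ} {c : Bool} :
    eastStep (extendRight f n c) n = c := by
  cases c <;> simp [eastStep, extendRight]

theorem eastStep_extendLeft {f : ℤ → ℤ} {n : ℤ} {c : Bool} :
    eastStep (extendLeft f n c) (n - 1) = c := by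
  cases c
  · simp [eastStep, extendLeft]
  · simp [eastStep, extendLeft]
    omega

theorem step_extendRight {f : ℤ → ℤ} {n : ℤ} {c : Bool} :
    extendRight f n c (n + 1) = extendRight f n c n ∨
      extendRight f n c (n + 1) = extendRight f n c n + 1 := by
  cases c <;> simp [extendRight]

theorem step_extendLeft {f : ℤ → ℤ} {n : ℤ} {c : Bool} :
    extendLeft f n c n = extendLeft f n c (n - 1) ∨
      extendLeft f n c n = extendLeft f n c (n - 1) + 1 := by
  cases c <;> simp [extendLeft]

theorem IsWalk.extendRight {lo hi : ℤ} {f : ℤ → ℤ} (hw : IsWalk I lo hi f) (hI : I (f hi) hi)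
    (c : Bool) : IsWalk I lo (hi + 1) (extendRight f hi c) := by
  obtain ⟨h1, h2, h3⟩ := hw
  refine ⟨by omega, fun d hd hd' => ?_, fun d hd hd' => ?_⟩
  · rw [extendRight_of_le (by omega)]
    rcases (Int.lt_add_one_iff.1 hd').eq_or_lt with rfl | hlt
    · exact hI
    · exact h2 d hd hlt
  · rcases (Int.lt_add_one_iff.1 hd').eq_or_lt with rfl | hlt
    · exact step_extendRight
    · rw [extendRight_of_le hlt.le, extendRight_of_le (by omega)]
      exact h3 d hd hlt

theorem IsWalk.extendLeft {lo hi : ℤ} {f : ℤ → ℤ} (hw : IsWalk I lo hi f) (hI : I (f lo) lo)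
    (c : Bool) : IsWalk I (lo - 1) hi (extendLeft f lo c) := by
  obtain ⟨h1, h2, h3⟩ := hw
  refine ⟨by omega, fun d hd hd' => ?_, fun d hd hd' => ?_⟩
  · rw [extendLeft_of_le (by omega)]
    rcases (Int.sub_one_lt_iff.1 hd).eq_or_lt with rfl | hlt
    · exact hI
    · exact h2 d hlt hd'
  · rcases hd.eq_or_lt with rfl | hlt
    · simpa using step_extendLeft (f := f) (n := lo) (c := c)
    · rw [extendLeft_of_le (by omega), extendLeft_of_le (by omega)]
      exact h3 d (by omega) hd'

/-- A compatible walk that ends at a vertex satisfying `I` can be extended by at least one of the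
two possible steps. -/
theorem Compatible.exists_extendRight (hT : IsTorsion I b T) {lo hi : ℤ} {f : ℤ → ℤ}
    (hw : IsWalk I lo hi f) (h : Compatible b T lo hi f) (hI : I (f hi) hi) :
    ∃ c, Compatible b T lo (hi + 1) (extendRight f hi c) := by
  have hf : ∀ c : Bool, ∀ d, d ≤ hi → GridTamari.extendRight f hi c d = f d :=
    fun c d hd => extendRight_of_le hd
  have hsub : ∀ (c : Bool) {i}, i ≤ hi →
      eastStep (GridTamari.extendRight f hi c) (i - 1) = eastStep f (i - 1) := fun c i h' =>
    eastStep_sub_one_congr (hf c i h') (hf c _ (by omega))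
  have hseg : ∀ {i}, lo < i → i ≤ hi → IsSegment I i hi f := fun {i} h1 h2 => by
    refine ⟨h2, fun d hd hd' => ?_, fun d _ _ => hw.2.2 d (by omega) (by omega)⟩
    rcases hd'.eq_or_lt with rfl | hlt
    · exact hI
    · exact hw.2.1 d (by omega) hlt
  by_cases hE : ∀ x, lo < x → x ≤ hi → eastStep f (x - 1) = b → T x hi f
  · refine ⟨!b, fun i j hp => ?_, fun i j hp ht => ?_⟩
    · obtain ⟨h1, h2, h3, h4, h5⟩ := id hp
      refine hT.congr (f := f) ?_ fun d _ _ => (hf _ d (by omega)).symm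
      rcases (Int.lt_add_one_iff.1 h3).eq_or_lt with rfl | hlt
      · exact hE i h1 h2 (by rwa [hsub _ h2] at h4)
      · exact h.1 i j (hp.congr h1 hlt fun d _ _ => hf _ d (by omega))
    · obtain ⟨h1, h2, h3, h4, h5⟩ := id hp
      rcases (Int.lt_add_one_iff.1 h3).eq_or_lt with rfl | hlt
      · rw [eastStep_extendRight] at h5
        exact bool_ne_not rfl h5
      · exact h.2 i j (hp.congr h1 hlt fun d _ _ => hf _ d (by omega))
          (hT.congr ht fun d _ _ => hf _ d (by omega))
  · push Not at hE
    obtain ⟨x, hx1, hx2, hx3, hx4⟩ := hE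
    refine ⟨b, fun i j hp => ?_, fun i j hp ht => ?_⟩
    · obtain ⟨h1, h2, h3, h4, h5⟩ := id hp
      rcases (Int.lt_add_one_iff.1 h3).eq_or_lt with rfl | hlt
      · rw [eastStep_extendRight] at h5
        exact (bool_ne_not rfl h5).elim
      · exact hT.congr (h.1 i j (hp.congr h1 hlt fun d _ _ => hf _ d (by omega)))
          fun d _ _ => (hf _ d (by omega)).symm
    · obtain ⟨h1, h2, h3, h4, h5⟩ := id hp
      have ht' := hT.congr ht fun d _ _ => hf _ d (by omega)
      rcases (Int.lt_add_one_iff.1 h3).eq_or_lt with rfl | hlt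
      · rw [hsub _ h2] at h4
        rcases lt_trichotomy x i with hxi | rfl | hxi
        · -- `[x, i - 1]` is an inner segment of kind `b`, so it lies in `T`
          refine hx4 (hT.cat (hseg hx1 hx2) (j := i - 1) (h.1 x (i - 1) ?_) (by simpa using ht'))
          exact ⟨hx1, by omega, by omega, hx3, h4⟩
        · exact hx4 ht'
        · exact hx4 (hT.sub ht' ⟨by omega, hx2, le_rfl, .inr hx3, .inl rfl⟩)
      · exact h.2 i j (hp.congr h1 hlt fun d _ _ => hf _ d (by omega)) ht'

theorem Compatible.exists_extendLeft (hT : IsTorsion I b T) {lo hi : ℤ} {f : ℤ → ℤ}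
    (hw : IsWalk I lo hi f) (h : Compatible b T lo hi f) (hI : I (f lo) lo) :
    ∃ c, Compatible b T (lo - 1) hi (extendLeft f lo c) := by
  have hf : ∀ c : Bool, ∀ d, lo ≤ d → GridTamari.extendLeft f lo c d = f d :=
    fun c d hd => extendLeft_of_le hd
  have hsub : ∀ (c : Bool) {j}, lo ≤ j →
      eastStep (GridTamari.extendLeft f lo c) j = eastStep f j := fun c j h' =>
    eastStep_congr (hf c j h') (hf c _ (by omega))
  have hseg : ∀ {j}, lo ≤ j → j < hi → IsSegment I lo j f := fun {j} h1 h2 => by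
    refine ⟨h1, fun d hd hd' => ?_, fun d _ _ => hw.2.2 d (by omega) (by omega)⟩
    rcases hd.eq_or_lt with rfl | hlt
    · exact hI
    · exact hw.2.1 d hlt (by omega)
  by_cases hE : ∀ x, lo ≤ x → x < hi → eastStep f x = (!b) → T lo x f
  · refine ⟨b, fun i j hp => ?_, fun i j hp ht => ?_⟩
    · obtain ⟨h1, h2, h3, h4, h5⟩ := id hp
      refine hT.congr (f := f) ?_ fun d _ _ => (hf _ d (by omega)).symm
      rcases (Int.sub_one_lt_iff.1 h1).eq_or_lt with rfl | hlt
      · exact hE j h2 h3 (by rwa [hsub _ h2] at h5)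
      · exact h.1 i j (hp.congr hlt h3 fun d _ _ => hf _ d (by omega))
    · obtain ⟨h1, h2, h3, h4, h5⟩ := id hp
      rcases (Int.sub_one_lt_iff.1 h1).eq_or_lt with rfl | hlt
      · rw [eastStep_extendLeft] at h4
        exact bool_ne_not rfl h4
      · exact h.2 i j (hp.congr hlt h3 fun d _ _ => hf _ d (by omega))
          (hT.congr ht fun d _ _ => hf _ d (by omega))
  · push Not at hE
    obtain ⟨x, hx1, hx2, hx3, hx4⟩ := hE
    refine ⟨!b, fun i j hp => ?_, fun i j hp ht => ?_⟩
    · obtain ⟨h1, h2, h3, h4, h5⟩ := id hp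
      rcases (Int.sub_one_lt_iff.1 h1).eq_or_lt with rfl | hlt
      · rw [eastStep_extendLeft] at h4
        exact (bool_ne_not rfl h4.symm).elim
      · exact hT.congr (h.1 i j (hp.congr hlt h3 fun d _ _ => hf _ d (by omega)))
          fun d _ _ => (hf _ d (by omega)).symm
    · obtain ⟨h1, h2, h3, h4, h5⟩ := id hp
      have ht' := hT.congr ht fun d _ _ => hf _ d (by omega)
      rcases (Int.sub_one_lt_iff.1 h1).eq_or_lt with rfl | hlt
      · rw [hsub _ h2, Bool.not_not] at h5
        rcases lt_trichotomy j x with hxi | rfl | hxi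
        · refine hx4 (hT.cat (hseg hx1 hx2) ht' (h.1 (j + 1) x ?_))
          exact ⟨by omega, by omega, by omega, by simpa using h5, hx3⟩
        · exact hx4 ht'
        · exact hx4 (hT.sub ht' ⟨le_rfl, hx1, by omega, .inl rfl, .inr hx3⟩)
      · exact h.2 i j (hp.congr hlt h3 fun d _ _ => hf _ d (by omega)) ht'

theorem Compatible.exists_fullWalk (hT : IsTorsion I b T)
    (hD : ∃ D : ℤ, ∀ x d, I x d → -D ≤ d ∧ d ≤ D) {lo hi : ℤ} {f : ℤ → ℤ}
    (hw : IsWalk I lo hi f) (h : Compatible b T lo hi f) :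
    ∃ lo' hi' g, lo' ≤ lo ∧ hi ≤ hi' ∧ (∀ d, lo ≤ d → d ≤ hi → g d = f d) ∧
      IsFullWalk I lo' hi' g ∧ Compatible b T lo' hi' g := by
  obtain ⟨D, hD⟩ := hD
  induction hn : (lo + D + 1).toNat + (D + 1 - hi).toNat using Nat.strong_induction_on
    generalizing lo hi f with
  | _ n ih =>
  by_cases h1 : I (f hi) hi
  · obtain ⟨c, hc⟩ := h.exists_extendRight hT hw h1
    have := hD _ _ h1
    obtain ⟨lo', hi', g, k1, k2, k3, k4⟩ := ih _ (by omega) (hw.extendRight h1 c) hc rfl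
    exact ⟨lo', hi', g, k1, by omega, fun d hd hd' => by
      rw [k3 d hd (by omega), extendRight_of_le hd'], k4⟩
  by_cases h2 : I (f lo) lo
  · obtain ⟨c, hc⟩ := h.exists_extendLeft hT hw h2
    have := hD _ _ h2
    obtain ⟨lo', hi', g, k1, k2, k3, k4⟩ := ih _ (by omega) (hw.extendLeft h2 c) hc rfl
    exact ⟨lo', hi', g, by omega, k2, fun d hd hd' => by
      rw [k3 d (by omega) hd', extendLeft_of_le hd], k4⟩
  · exact ⟨lo, hi, f, le_rfl, le_rfl, fun _ _ _ => rfl, ⟨hw, h2, h1⟩, h⟩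

/-- The segment `[a, c]` of `s`, entered by a step of kind `e` and left by a step of kind `e'`, is
part of a compatible path if this is permitted by its subsegments. -/
theorem exists_fullWalk_of_segment (hT : IsTorsion I b T)
    (hD : ∃ D : ℤ, ∀ x d, I x d → -D ≤ d ∧ d ≤ D) {a c : ℤ} {s : ℤ → ℤ} (hs : IsSegment I a c s)
    (e e' : Bool)
    (h1 : ∀ i j, a ≤ i → i ≤ j → j ≤ c → (i = a → e = b) → (i ≠ a → eastStep s (i - 1) = b) →
      (j = c → e' = !b) → (j ≠ c → eastStep s j = !b) → T i j s)
    (h2 : ∀ i j, a ≤ i → i ≤ j → j ≤ c → (i = a → e = !b) → (i ≠ a → eastStep s (i - 1) = !b) →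
      (j = c → e' = b) → (j ≠ c → eastStep s j = b) → ¬ T i j s) :
    ∃ lo hi f, IsFullWalk I lo hi f ∧ Compatible b T lo hi f ∧ lo < a ∧ c < hi ∧
      (∀ d, a ≤ d → d ≤ c → f d = s d) ∧ eastStep f (a - 1) = e ∧ eastStep f c = e' := by
  let g := extendLeft (extendRight s c e') a e
  have hac := hs.1
  have hg : ∀ d, a ≤ d → d ≤ c → g d = s d := fun d hd hd' => by
    simp only [g]
    rw [extendLeft_of_le hd, extendRight_of_le hd']
  have hg' : ∀ d, a ≤ d → g d = extendRight s c e' d := fun d hd => extendLeft_of_le hd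
  have hga : eastStep g (a - 1) = e := eastStep_extendLeft
  have hgc : eastStep g c = e' := by
    rw [eastStep_congr (hg' c hac) (hg' _ (by omega)), eastStep_extendRight]
  have hl : ∀ i, i ≠ a → a ≤ i → i ≤ c → eastStep g (i - 1) = eastStep s (i - 1) :=
    fun i _ _ _ => eastStep_sub_one_congr (hg i (by omega) (by omega)) (hg _ (by omega) (by omega))
  have hr : ∀ i, i ≠ c → a ≤ i → i ≤ c → eastStep g i = eastStep s i :=
    fun i _ _ _ => eastStep_congr (hg i (by omega) (by omega)) (hg _ (by omega) (by omega))
  have hw : IsWalk I (a - 1) (c + 1) g := by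
    refine ⟨by omega, fun d _ _ => ?_, fun d hd hd' => ?_⟩
    · rw [hg d (by omega) (by omega)]
      exact hs.2.1 d (by omega) (by omega)
    · rcases hd.eq_or_lt with rfl | hlt
      · simpa using step_extendLeft (f := extendRight s c e') (n := a) (c := e)
      · rcases (Int.lt_add_one_iff.1 hd').eq_or_lt with rfl | hlt'
        · rw [hg' _ (by omega), hg' _ (by omega)]
          exact step_extendRight
        · rw [hg _ (by omega) (by omega), hg _ (by omega) (by omega)]
          exact hs.2.2 d (by omega) hlt'
  have hc : Compatible b T (a - 1) (c + 1) g := by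
    refine ⟨fun i j hp => ?_, fun i j hp ht => ?_⟩ <;> obtain ⟨k1, k2, k3, k4, k5⟩ := hp
    · refine hT.congr (h1 i j (by omega) k2 (by omega) ?_ ?_ ?_ ?_)
        fun d _ _ => (hg d (by omega) (by omega)).symm
      · rintro rfl; rw [← hga, k4]
      · intro hne; rw [← hl i hne (by omega) (by omega), k4]
      · rintro rfl; rw [← hgc, k5]
      · intro hne; rw [← hr j hne (by omega) (by omega), k5]
    · rw [Bool.not_not] at k5
      refine h2 i j (by omega) k2 (by omega) ?_ ?_ ?_ ?_
        (hT.congr ht fun d _ _ => hg d (by omega) (by omega))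
      · rintro rfl; rw [← hga, k4]
      · intro hne; rw [← hl i hne (by omega) (by omega), k4]
      · rintro rfl; rw [← hgc, k5]
      · intro hne; rw [← hr j hne (by omega) (by omega), k5]
  obtain ⟨lo, hi, f, hlo, hhi, hf, hfull, hcomp⟩ := hc.exists_fullWalk hT hD hw
  refine ⟨lo, hi, f, hfull, hcomp, by omega, by omega, fun d hd hd' => ?_, ?_, ?_⟩
  · rw [hf d (by omega) (by omega), hg d hd hd']
  · rw [eastStep_sub_one_congr (hf a (by omega) (by omega)) (hf _ (by omega) (by omega)), hga]
  · rw [eastStep_congr (hf c (by omega) (by omega)) (hf _ (by omega) (by omega)), hgc]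

/-- Every segment in `T` has a piece of kind `!b` which is an inner segment of kind `b` of a
compatible path. -/
theorem exists_compatible_of_mem (hT : IsTorsion I b T)
    (hD : ∃ D : ℤ, ∀ x d, I x d → -D ≤ d ∧ d ≤ D) {i j : ℤ} {s : ℤ → ℤ} (h : T i j s) :
    ∃ a c, Piece (!b) s i j a c ∧ ∃ lo hi f, IsFullWalk I lo hi f ∧ Compatible b T lo hi f ∧
      Inner b f lo hi a c ∧ ∀ d, a ≤ d → d ≤ c → f d = s d := by
  obtain ⟨a, c, hp, ho, hmin⟩ := hT.isTorsion_orth.exists_piece_orth (hT.seg h)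
    (fun ho => ho.not_mem h)
  rw [hT.orth_orth] at ho
  obtain ⟨lo, hi, f, h1, h2, h3, h4, h5, h6, h7⟩ := exists_fullWalk_of_segment hT hD (hT.seg ho)
    b (!b) (fun i j k1 k2 k3 k4 k5 k6 k7 => hT.sub ho
      ⟨k1, k2, k3, or_iff_not_imp_left.2 k5, or_iff_not_imp_left.2 k7⟩)
    (fun i j k1 k2 k3 k4 k5 k6 k7 => by
      have hi : i ≠ a := fun hi => bool_ne_not rfl (k4 hi)
      have hj : j ≠ c := fun hj => bool_ne_not rfl (k6 hj).symm
      exact (hmin i j ⟨k1, k2, k3, .inr (k5 hi), .inr (by simpa using k7 hj)⟩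
        (.inl (by omega))).not_mem)
  exact ⟨a, c, hp, lo, hi, f, h1, h2, ⟨h3, (hT.seg ho).1, h4, h6, h7⟩, h5⟩

/-- Every segment outside of `T` has a piece of kind `b` which is an inner segment of kind `!b` of a
compatible path. -/
theorem exists_compatible_of_not_mem (hT : IsTorsion I b T)
    (hD : ∃ D : ℤ, ∀ x d, I x d → -D ≤ d ∧ d ≤ D) {i j : ℤ} {s : ℤ → ℤ} (hs : IsSegment I i j s)
    (h : ¬ T i j s) :
    ∃ a c, Piece b s i j a c ∧ ∃ lo hi f, IsFullWalk I lo hi f ∧ Compatible b T lo hi f ∧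
      Inner (!b) f lo hi a c ∧ ∀ d, a ≤ d → d ≤ c → f d = s d := by
  obtain ⟨i', j', hp, ho, -⟩ := hT.exists_piece_orth hs h
  obtain ⟨a, c, hp', lo, hi, f, hw, hc, hin, hf⟩ :=
    exists_compatible_of_mem hT.isTorsion_orth hD ho
  rw [Bool.not_not] at hp'
  exact ⟨a, c, hp.trans hp', lo, hi, f, hw, hc.of_dual hT hw.1, hin, hf⟩

/-- Two compatible paths with the label of a cover as an inner segment of kind `b` cannot diverge:
otherwise, extending the label to the point of divergence would give another segment in `T` that is
torsion-free for `T'`. -/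
theorem IsLabel.eq_of_inner_of_le (hT : IsTorsion I b T) (hT' : IsTorsion I b T')
    (hle : ∀ i j f, T' i j f → T i j f) {a c : ℤ} {s : ℤ → ℤ} (hl : IsLabel I b T' T a c s)
    {lo hi lo' hi' : ℤ} {f f' : ℤ → ℤ} (hw : IsFullWalk I lo hi f) (hw' : IsFullWalk I lo' hi' f')
    (h : Compatible b T lo hi f) (h' : Compatible b T lo' hi' f')
    (hin : Inner b f lo hi a c) (hin' : Inner b f' lo' hi' a c)
    (hs : ∀ d, a ≤ d → d ≤ c → f d = s d) (hs' : ∀ d, a ≤ d → d ≤ c → f' d = s d) :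
    lo' ≤ lo ∧ hi ≤ hi' ∧ ∀ d, lo ≤ d → d ≤ hi → f d = f' d := by
  have hac := hin.2.1
  -- one of the two walks leaves `[a, y]` by a step of kind `!b`, the other by a step of kind `b`
  have right : ∀ {lo hi lo' hi' : ℤ} {f f' : ℤ → ℤ}, IsWalk I lo hi f → IsWalk I lo' hi' f' →
      Compatible b T lo hi f → Compatible b T lo' hi' f' → Inner b f lo hi a c →
      Inner b f' lo' hi' a c → (∀ d, a ≤ d → d ≤ c → f d = s d) →
      ∀ y, c < y → y < hi → y < hi' → (∀ d, a ≤ d → d ≤ y → f d = f' d) →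
      eastStep f y = (!b) → eastStep f' y = b → False := by
    intro lo hi lo' hi' f f' hw hw' h h' hin hin' hs y hcy hy hy' hff e e'
    have t1 : T a y f := h.1 a y ⟨hin.1, by omega, hy, hin.2.2.2.1, e⟩
    have t2 : orth I b T (c + 1) y f' := h'.orth_of_inner hw'
      ⟨by have := hin'.1; omega, by omega, hy', by simpa using hin'.2.2.2.2, by simpa using e'⟩
    have t3 : orth I b T' a y f := hT'.isTorsion_orth.cat (hT.seg t1)
      (hT'.isTorsion_orth.congr hl.mem_orth fun d hd hd' => (hs d hd hd').symm)
      (hT'.isTorsion_orth.congr (t2.anti hle) fun d hd hd' => (hff d (by omega) hd').symm)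
    have := (hl.unique t1 t3).2.1
    omega
  have left : ∀ {lo hi lo' hi' : ℤ} {f f' : ℤ → ℤ}, IsWalk I lo hi f → IsWalk I lo' hi' f' →
      Compatible b T lo hi f → Compatible b T lo' hi' f' → Inner b f lo hi a c →
      Inner b f' lo' hi' a c → (∀ d, a ≤ d → d ≤ c → f d = s d) →
      ∀ y, y < a → lo < y → lo' < y → (∀ d, y ≤ d → d ≤ c → f d = f' d) →
      eastStep f (y - 1) = b → eastStep f' (y - 1) = (!b) → False := by
    intro lo hi lo' hi' f f' hw hw' h h' hin hin' hs y hya hy hy' hff e e'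
    have t1 : T y c f := h.1 y c ⟨hy, by omega, hin.2.2.1, e, hin.2.2.2.2⟩
    have t2 : orth I b T y (a - 1) f' := h'.orth_of_inner hw'
      ⟨hy', by omega, by have := hin'.2.2.1; omega, e', by simpa using hin'.2.2.2.1⟩
    have t3 : orth I b T' y c f := hT'.isTorsion_orth.cat (hT.seg t1) (j := a - 1)
      (hT'.isTorsion_orth.congr (t2.anti hle) fun d hd hd' => (hff d hd (by omega)).symm)
      (by simpa using hT'.isTorsion_orth.congr hl.mem_orth fun d hd hd' => (hs d hd hd').symm)
    have := (hl.unique t1 t3).1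
    omega
  have step : ∀ d, lo ≤ d → d < hi → lo' ≤ d → d < hi' → eastStep f d = eastStep f' d →
      (f (d + 1) - f d = f' (d + 1) - f' d) := by
    intro d h1 h2 h3 h4 e
    have k := hw.1.2.2 d h1 h2
    have k' := hw'.1.2.2 d h3 h4
    simp only [eastStep, decide_eq_decide] at e
    omega
  have hR : ∀ n : ℕ, c + n ≤ hi → c + n ≤ hi' ∧ ∀ d, a ≤ d → d ≤ c + n → f d = f' d := by
    intro n
    induction n with
    | zero =>
      intro _
      have := hin'.2.2.1
      refine ⟨by simp; omega, fun d hd hd' => ?_⟩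
      rw [hs d hd (by simpa using hd'), hs' d hd (by simpa using hd')]
    | succ n ih =>
      intro hn
      push_cast at hn ⊢
      obtain ⟨ih1, ih2⟩ := ih (by omega)
      have hIf : I (f' (c + n)) (c + n) := by
        rw [← ih2 _ (by omega) le_rfl]
        exact hw.1.2.1 _ (by have := hin.1; omega) (by omega)
      have hne : c + n ≠ hi' := fun hc => hw'.2.2 (hc ▸ hIf)
      have he : eastStep f (c + n) = eastStep f' (c + n) := by
        rcases Nat.eq_zero_or_pos n with rfl | hpos
        · simp [hin.2.2.2.2, hin'.2.2.2.2]
        by_contra hne'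
        rcases bool_eq_or_eq_not (eastStep f (c + n)) b with e | e
        · refine right hw'.1 hw.1 h' h hin' hin hs' (c + n) (by omega) (by omega) (by omega)
            (fun d hd hd' => (ih2 d hd hd').symm) ?_ e
          exact (bool_eq_or_eq_not _ b).resolve_left fun e' => hne' (e.trans e'.symm)
        · refine right hw.1 hw'.1 h h' hin hin' hs (c + n) (by omega) (by omega) (by omega)
            ih2 e ?_
          exact (bool_eq_or_eq_not _ b).resolve_right fun e' => hne' (e.trans e'.symm)
      refine ⟨by omega, fun d hd hd' => ?_⟩
      rcases (show d ≤ c + n ∨ d = c + n + 1 by omega) with hle' | rfl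
      · exact ih2 d hd hle'
      · have := step (c + n) (by have := hin.1; omega) (by omega) (by have := hin'.1; omega)
          (by omega) he
        have := ih2 (c + n) (by omega) le_rfl
        omega
  have hL : ∀ n : ℕ, lo ≤ a - n → lo' ≤ a - n ∧ ∀ d, a - n ≤ d → d ≤ c → f d = f' d := by
    intro n
    induction n with
    | zero =>
      intro _
      have := hin'.1
      refine ⟨by simp; omega, fun d hd hd' => ?_⟩
      rw [hs d (by simpa using hd) hd', hs' d (by simpa using hd) hd']
    | succ n ih =>
      intro hn
      push_cast at hn ⊢
      obtain ⟨ih1, ih2⟩ := ih (by omega)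
      have hIf : I (f' (a - n)) (a - n) := by
        rw [← ih2 _ le_rfl (by omega)]
        exact hw.1.2.1 _ (by omega) (by have := hin.2.2.1; omega)
      have hne : a - n ≠ lo' := fun hc => hw'.2.1 (hc ▸ hIf)
      have he : eastStep f (a - n - 1) = eastStep f' (a - n - 1) := by
        rcases Nat.eq_zero_or_pos n with rfl | hpos
        · simp [hin.2.2.2.1, hin'.2.2.2.1]
        by_contra hne'
        rcases bool_eq_or_eq_not (eastStep f (a - n - 1)) b with e | e
        · refine left hw.1 hw'.1 h h' hin hin' hs (a - n) (by omega) (by omega) (by omega)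
            ih2 e ?_
          exact (bool_eq_or_eq_not _ b).resolve_left fun e' => hne' (e.trans e'.symm)
        · refine left hw'.1 hw.1 h' h hin' hin hs' (a - n) (by omega) (by omega) (by omega)
            (fun d hd hd' => (ih2 d hd hd').symm) ?_ e
          exact (bool_eq_or_eq_not _ b).resolve_right fun e' => hne' (e.trans e'.symm)
      refine ⟨by omega, fun d hd hd' => ?_⟩
      rcases (show a - n ≤ d ∨ d = a - n - 1 by omega) with hle' | rfl
      · exact ih2 d hle' hd'
      · have := step (a - n - 1) (by omega) (by have := hin.2.2.1; omega) (by omega)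
          (by have := hin'.2.2.1; omega) he
        have := ih2 (a - n) le_rfl (by omega)
        simp only [sub_add_cancel] at *
        omega
  have h1 := hin.1
  have h2 := hin.2.2.1
  have r := hR (hi - c).toNat (by omega)
  have l := hL (a - lo).toNat (by omega)
  refine ⟨by omega, by omega, fun d hd hd' => ?_⟩
  rcases le_total a d with had | had
  · exact r.2 d had (by omega)
  · exact l.2 d (by omega) (by omega)

theorem IsLabel.eq_of_inner (hT : IsTorsion I b T) (hT' : IsTorsion I b T')
    (hle : ∀ i j f, T' i j f → T i j f) {a c : ℤ} {s : ℤ → ℤ} (hl : IsLabel I b T' T a c s)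
    {lo hi lo' hi' : ℤ} {f f' : ℤ → ℤ} (hw : IsFullWalk I lo hi f) (hw' : IsFullWalk I lo' hi' f')
    (h : Compatible b T lo hi f) (h' : Compatible b T lo' hi' f')
    (hin : Inner b f lo hi a c) (hin' : Inner b f' lo' hi' a c)
    (hs : ∀ d, a ≤ d → d ≤ c → f d = s d) (hs' : ∀ d, a ≤ d → d ≤ c → f' d = s d) :
    lo = lo' ∧ hi = hi' ∧ ∀ d, lo ≤ d → d ≤ hi → f d = f' d := by
  have k := hl.eq_of_inner_of_le hT hT' hle hw hw' h h' hin hin' hs hs'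
  have k' := hl.eq_of_inner_of_le hT hT' hle hw' hw h' h hin' hin hs' hs
  exact ⟨by omega, by omega, k.2.2⟩

/-- The label of a cover is an inner segment of kind `b` of a path compatible with the larger
torsion class. -/
theorem IsLabel.exists_compatible (hT : IsTorsion I b T) (hT' : IsTorsion I b T')
    (hD : ∃ D : ℤ, ∀ x d, I x d → -D ≤ d ∧ d ≤ D) {a c : ℤ} {s : ℤ → ℤ}
    (hl : IsLabel I b T' T a c s) :
    ∃ lo hi f, IsFullWalk I lo hi f ∧ Compatible b T lo hi f ∧
      Inner b f lo hi a c ∧ ∀ d, a ≤ d → d ≤ c → f d = s d := by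
  obtain ⟨lo, hi, f, h1, h2, h3, h4, h5, h6, h7⟩ := exists_fullWalk_of_segment hT hD
    (hT.seg hl.mem) b (!b) (fun i j k1 k2 k3 k4 k5 k6 k7 => hT.sub hl.mem
      ⟨k1, k2, k3, or_iff_not_imp_left.2 k5, or_iff_not_imp_left.2 k7⟩)
    (fun i j k1 k2 k3 k4 k5 k6 k7 ht => by
      have hi : i ≠ a := fun hi => bool_ne_not rfl (k4 hi)
      exact hi (hl.unique ht (hT'.isTorsion_orth.sub hl.mem_orth
        ⟨k1, k2, k3, .inr (k5 hi), or_iff_not_imp_left.2 (by simpa using k7)⟩)).1)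
  exact ⟨lo, hi, f, h1, h2, ⟨h3, (hT.seg hl.mem).1, h4, h6, h7⟩, h5⟩

/-! ### A path is involved in at most one cover -/

variable {T₁ T₂ : ℤ → ℤ → (ℤ → ℤ) → Prop}

/-- Half of `IsLabel.not_inner_inner`: the case where the label `[a₁, c₁]` of the lower cover starts
before the end of the label `[a₂, c₂]` of the upper cover. Then the walk enters and leaves
`[a₁, c₂]` by steps of kind `b`. Depending on whether a beginning of this segment lies in `T`, one
finds another compatible path, which either enters `[a₁, c₂]` as the given one and leaves the
given one at the end of that beginning, or leaves `[a₁, c₂]` as the given one and enters it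
differently; one of the labels rules this
out. -/
theorem IsLabel.not_inner_inner_of_le (hT₁ : IsTorsion I b T₁) (hT : IsTorsion I b T)
    (hT₂ : IsTorsion I b T₂) (hle₁ : ∀ i j f, T₁ i j f → T i j f)
    (hle₂ : ∀ i j f, T i j f → T₂ i j f)
    (hD : ∃ D : ℤ, ∀ x d, I x d → -D ≤ d ∧ d ≤ D) {a₁ c₁ a₂ c₂ : ℤ} {s₁ s₂ : ℤ → ℤ}
    (hl₁ : IsLabel I b T₁ T a₁ c₁ s₁) (hl₂ : IsLabel I b T T₂ a₂ c₂ s₂)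
    {lo hi : ℤ} {f : ℤ → ℤ} (hw : IsFullWalk I lo hi f) (h : Compatible b T lo hi f)
    (hin₁ : Inner b f lo hi a₁ c₁) (hin₂ : Inner (!b) f lo hi a₂ c₂)
    (hs₁ : ∀ d, a₁ ≤ d → d ≤ c₁ → f d = s₁ d) (hs₂ : ∀ d, a₂ ≤ d → d ≤ c₂ → f d = s₂ d)
    (hac : a₁ ≤ c₂) : False := by
  obtain ⟨p1, p2, p3, p4, p5⟩ := id hin₁
  obtain ⟨q1, q2, q3, q4, q5⟩ := id hin₂
  rw [Bool.not_not] at q5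
  by_cases hk : ∃ k, a₁ ≤ k ∧ k ≤ c₂ ∧ eastStep f k = b ∧ T a₁ k f
  · obtain ⟨k, k1, k2, k3, k4⟩ := hk
    obtain ⟨lo', hi', g, g1, g2, g3, g4, g5, g6, g7⟩ := exists_fullWalk_of_segment hT hD
      (hT.seg k4) b (!b)
      (fun i j m1 m2 m3 m4 m5 m6 m7 => hT.sub k4
        ⟨m1, m2, m3, or_iff_not_imp_left.2 m5, or_iff_not_imp_left.2 m7⟩)
      (fun i j m1 m2 m3 m4 m5 m6 m7 => by
        have hi : i ≠ a₁ := fun hi => bool_ne_not rfl (m4 hi)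
        have hj : j ≠ k := fun hj => bool_ne_not rfl (m6 hj).symm
        exact h.2 i j ⟨by omega, m2, by omega, m5 hi, by simpa using m7 hj⟩)
    rcases lt_trichotomy k c₁ with hkc | rfl | hkc
    · have := (hl₁.unique k4 (hT₁.isTorsion_orth.congr (hT₁.isTorsion_orth.sub hl₁.mem_orth
        (Piece.congr ⟨le_rfl, k1, hkc.le, .inl rfl, .inr (by simpa using k3)⟩ hs₁))
        fun d _ _ => (hs₁ d (by omega) (by omega)).symm)).2.1
      omega
    · exact bool_ne_not k3 p5
    · have hin : Inner b g lo' hi' a₁ c₁ := by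
        refine ⟨g3, p2, by omega, g6, ?_⟩
        rw [eastStep_congr (g5 _ (by omega) (by omega)) (g5 _ (by omega) (by omega)), p5]
      have := hl₁.eq_of_inner hT hT₁ hle₁ hw g1 h g2 hin₁ hin hs₁
        (fun d hd hd' => (g5 d hd (by omega)).trans (hs₁ d hd hd'))
      refine bool_ne_not k3 (g7 ▸ ?_)
      exact eastStep_congr (this.2.2 _ (by omega) (by omega)) (this.2.2 _ (by omega) (by omega))
  · push Not at hk
    have hz : ∀ i j, a₁ ≤ i → i ≤ j → j ≤ c₂ → (i ≠ a₁ → eastStep f (i - 1) = !b) →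
        (j ≠ c₂ → eastStep f j = b) → ¬ T i j f := by
      intro i j m1 m2 m3 m5 m7 ht
      have hj : eastStep f j = b := by
        by_cases hj : j = c₂
        · rw [hj, q5]
        · exact m7 hj
      by_cases hi : i = a₁
      · subst hi
        exact hk j m2 m3 hj ht
      · exact h.2 i j ⟨by omega, m2, by omega, m5 hi, by simpa using hj⟩ ht
    have hseg := hw.1.isSegment p1 hac q3
    obtain ⟨lo', hi', g, g1, g2, g3, g4, g5, g6, g7⟩ := exists_fullWalk_of_segment hT hD
      hseg (!b) b
      (fun i j m1 m2 m3 m4 m5 m6 m7 => by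
        have hi : i ≠ a₁ := fun hi => bool_ne_not rfl (m4 hi).symm
        have hj : j ≠ c₂ := fun hj => bool_ne_not rfl (m6 hj)
        exact h.1 i j ⟨by omega, m2, by omega, m5 hi, m7 hj⟩)
      (fun i j m1 m2 m3 _ m5 _ m7 => hz i j m1 m2 m3 m5 m7)
    have ho : orth I b T a₁ c₂ f := ⟨hseg, fun i j hp => hz i j hp.1 hp.2.1 hp.2.2.1
      (fun hi => hp.2.2.2.1.resolve_left hi) fun hj => by simpa using hp.2.2.2.2.resolve_left hj⟩
    rcases lt_trichotomy a₂ a₁ with hkc | rfl | hkc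
    · have := (hl₂.unique (hT₂.congr (hT₂.sub hl₂.mem
        (Piece.congr ⟨hkc.le, hac, le_rfl, .inr p4, .inl rfl⟩ hs₂))
        fun d _ _ => (hs₂ d (by omega) (by omega)).symm) ho).1
      omega
    · exact bool_ne_not p4 q4
    · have hin : Inner (!b) g lo' hi' a₂ c₂ := by
        refine ⟨by omega, q2, g4, ?_, by simpa using g7⟩
        rw [eastStep_sub_one_congr (g5 _ (by omega) (by omega)) (g5 _ (by omega) (by omega)), q4]
      have := (hl₂.dual hT₂).eq_of_inner hT.isTorsion_orth hT₂.isTorsion_orth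
        (fun _ _ _ ho => ho.anti hle₂) hw g1 (h.dual hw.1) (g2.dual g1.1) hin₂ hin hs₂
        (fun d hd hd' => (g5 d (by omega) hd').trans (hs₂ d hd hd'))
      refine bool_ne_not p4 (g6 ▸ ?_)
      exact eastStep_sub_one_congr (this.2.2 _ (by omega) (by omega))
        (this.2.2 _ (by omega) (by omega))

/-- For covers `T₁ ⋖ T ⋖ T₂`, no path that is compatible with `T` has both labels as inner
segments. -/
theorem IsLabel.not_inner_inner (hT₁ : IsTorsion I b T₁) (hT : IsTorsion I b T)
    (hT₂ : IsTorsion I b T₂) (hle₁ : ∀ i j f, T₁ i j f → T i j f)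
    (hle₂ : ∀ i j f, T i j f → T₂ i j f)
    (hD : ∃ D : ℤ, ∀ x d, I x d → -D ≤ d ∧ d ≤ D) {a₁ c₁ a₂ c₂ : ℤ} {s₁ s₂ : ℤ → ℤ}
    (hl₁ : IsLabel I b T₁ T a₁ c₁ s₁) (hl₂ : IsLabel I b T T₂ a₂ c₂ s₂)
    {lo hi : ℤ} {f : ℤ → ℤ} (hw : IsFullWalk I lo hi f) (h : Compatible b T lo hi f)
    (hin₁ : Inner b f lo hi a₁ c₁) (hin₂ : Inner (!b) f lo hi a₂ c₂)
    (hs₁ : ∀ d, a₁ ≤ d → d ≤ c₁ → f d = s₁ d) (hs₂ : ∀ d, a₂ ≤ d → d ≤ c₂ → f d = s₂ d) :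
    False := by
  rcases le_or_gt a₁ c₂ with hac | hac
  · exact hl₁.not_inner_inner_of_le hT₁ hT hT₂ hle₁ hle₂ hD hl₂ hw h hin₁ hin₂ hs₁ hs₂ hac
  · have h1 := hin₁.2.1
    have h2 := hin₂.2.1
    exact (hl₂.dual hT₂).not_inner_inner_of_le hT₂.isTorsion_orth hT.isTorsion_orth
      hT₁.isTorsion_orth (fun _ _ _ ho => ho.anti hle₂) (fun _ _ _ ho => ho.anti hle₁) hD
      (hl₁.dual hT) hw (h.dual hw.1) hin₂ (by simpa using hin₁) hs₂ hs₁ (by omega)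

end GridTamari

/-! ### Congruences of finite lattices -/

namespace LatticeCon

variable {L : Type*} [Lattice L]

theorem con_le_iff {x y : L} {c : LatticeCon L} : con x y ≤ c ↔ c.r x y :=
  ⟨fun h => h x y fun _ hd => hd, fun h => sInf_le h⟩

theorem con_rel (x y : L) : (con x y).r x y := con_le_iff.1 le_rfl

/-- Equality, as a lattice congruence. -/
def eqCon (L : Type*) [Lattice L] : LatticeCon L where
  r := Eq
  iseqv := eq_equivalence
  inf := by rintro _ _ _ _ rfl rfl; rfl
  sup := by rintro _ _ _ _ rfl rfl; rfl

/-- The join of two congruences, as the equivalence relation generated by them. -/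
def joinCon (c d : LatticeCon L) : LatticeCon L where
  r := Relation.EqvGen fun x y => c.r x y ∨ d.r x y
  iseqv := Relation.EqvGen.is_equivalence _
  inf := by
    have key : ∀ {w x : L} (y : L), Relation.EqvGen (fun x y => c.r x y ∨ d.r x y) w x →
        Relation.EqvGen (fun x y => c.r x y ∨ d.r x y) (w ⊓ y) (x ⊓ y) := by
      intro w x y h
      induction h with
      | rel a b h => exact .rel _ _ (h.imp (c.inf · (c.refl y)) (d.inf · (d.refl y)))
      | refl a => exact .refl _
      | symm a b _ ih => exact .symm _ _ ih
      | trans a b e _ _ ih ih' => exact .trans _ _ _ ih ih'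
    intro w x y z h h'
    refine .trans _ (x ⊓ y) _ (key y h) ?_
    rw [inf_comm x, inf_comm x]
    exact key x h'
  sup := by
    have key : ∀ {w x : L} (y : L), Relation.EqvGen (fun x y => c.r x y ∨ d.r x y) w x →
        Relation.EqvGen (fun x y => c.r x y ∨ d.r x y) (w ⊔ y) (x ⊔ y) := by
      intro w x y h
      induction h with
      | rel a b h => exact .rel _ _ (h.imp (c.sup · (c.refl y)) (d.sup · (d.refl y)))
      | refl a => exact .refl _
      | symm a b _ ih => exact .symm _ _ ih
      | trans a b e _ _ ih ih' => exact .trans _ _ _ ih ih'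
    intro w x y z h h'
    refine .trans _ (x ⊔ y) _ (key y h) ?_
    rw [sup_comm x, sup_comm x]
    exact key x h'

theorem sup_le_joinCon (c d : LatticeCon L) : c ⊔ d ≤ joinCon c d :=
  sup_le (fun _ _ h => .rel _ _ (.inl h)) (fun _ _ h => .rel _ _ (.inr h))

/-- A chain of relations from `x` to `y` can be projected to `[x, y] = {x, y}`, so a join of two
congruences identifies `x` and `y` only if one of the two does. -/
theorem supIrred_con {x y : L} (h : x ⋖ y) : SupIrred (con x y) := by
  constructor
  · intro hmin
    have hle : con x y ≤ eqCon L := hmin (b := eqCon L) fun u v huv => huv ▸ (con x y).refl u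
    exact h.ne (con_le_iff.1 hle)
  · intro c d hcd
    have hrel : (joinCon c d).r x y := con_le_iff.1 (hcd ▸ sup_le_joinCon c d)
    by_contra hne
    push Not at hne
    have hc : ¬ c.r x y := fun hc =>
      hne.1 (le_antisymm (hcd ▸ le_sup_left) (con_le_iff.2 hc))
    have hd : ¬ d.r x y := fun hd =>
      hne.2 (le_antisymm (hcd ▸ le_sup_right) (con_le_iff.2 hd))
    have hproj : ∀ u, (x ⊔ u) ⊓ y = x ∨ (x ⊔ u) ⊓ y = y := fun u =>
      h.eq_or_eq (le_inf le_sup_left h.le) inf_le_right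
    have key : ∀ e : LatticeCon L, ¬ e.r x y → ∀ u v, e.r u v →
        (x ⊔ u) ⊓ y = (x ⊔ v) ⊓ y := by
      intro e he u v huv
      have := e.inf (e.sup (e.refl x) huv) (e.refl y)
      rcases hproj u with hu | hu <;> rcases hproj v with hv | hv <;> rw [hu, hv] at this ⊢
      · exact (he this).elim
      · exact (he (e.symm this)).elim
    have hall : ∀ u v, Relation.EqvGen (fun x y => c.r x y ∨ d.r x y) u v →
        (x ⊔ u) ⊓ y = (x ⊔ v) ⊓ y := by
      intro u v huv
      induction huv with
      | rel a b h => exact h.elim (key c hc a b) (key d hd a b)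
      | refl a => rfl
      | symm a b _ ih => exact ih.symm
      | trans a b e _ _ ih ih' => exact ih.trans ih'
    have := hall x y hrel
    rw [sup_idem, sup_eq_right.2 h.le, inf_idem, inf_eq_left.2 h.le] at this
    exact h.ne this

theorem exists_covBy_of_supIrred [Finite L] {c : LatticeCon L} (hc : SupIrred c) :
    ∃ x y : L, x ⋖ y ∧ con x y = c := by
  classical
  have := Fintype.ofFinite L
  let _ : LocallyFiniteOrder L := Fintype.toLocallyFiniteOrder
  let S : Finset (L × L) := Finset.univ.filter fun z => z.1 ⋖ z.2 ∧ c.r z.1 z.2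
  have hS : S.sup (fun z => con z.1 z.2) = c := by
    refine le_antisymm (Finset.sup_le fun z hz => con_le_iff.2 (Finset.mem_filter.1 hz).2.2) ?_
    intro u v huv
    rw [← r_inf_sup_iff] at huv ⊢
    generalize hu : u ⊓ v = u' at huv ⊢
    generalize hv : u ⊔ v = v' at huv ⊢
    have huv' : u' ≤ v' := hu ▸ hv ▸ inf_le_sup
    have hbet : ∀ z, u' ≤ z → z ≤ v' → c.r u' z := fun z h1 h2 => by
      have := c.inf huv (c.refl z)
      rwa [inf_eq_left.2 h1, inf_eq_right.2 h2] at this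
    have hcov : ∀ y z, y ⋖ z → c.r y z → (S.sup fun z => con z.1 z.2).r y z := fun y z h h' =>
      Finset.le_sup (f := fun z : L × L => con z.1 z.2) (b := (y, z))
        (Finset.mem_filter.2 ⟨Finset.mem_univ _, h, h'⟩) _ _ (con_rel y z)
    generalize (S.sup fun z => con z.1 z.2) = e at hcov ⊢
    have key : ∀ z, Relation.ReflTransGen (· ⋖ ·) u' z → z ≤ v' → e.r u' z := by
      intro z hz
      induction hz with
      | refl => exact fun _ => e.refl u'
      | @tail y z h h' ih =>
        intro hzv
        have hyu : u' ≤ y := le_iff_reflTransGen_covBy.2 h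
        exact e.trans (ih (h'.le.trans hzv)) (hcov y z h'
          (c.trans (c.symm (hbet y hyu (h'.le.trans hzv))) (hbet z (hyu.trans h'.le) hzv)))
    exact key v' (le_iff_reflTransGen_covBy.1 huv') le_rfl
  obtain ⟨z, hz, hzc⟩ := hc.finset_sup_eq hS
  exact ⟨z.1, z.2, (Finset.mem_filter.1 hz).2.1, hzc⟩

end LatticeCon

section Stars

variable {L : Type*} [Lattice L]

theorem SupIrred.le_of_covBy {j x z : L} (hj : SupIrred j) (hx : x ⋖ j) (hz : z < j) : z ≤ x := by
  by_contra hzx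
  rcases hx.eq_or_eq (le_sup_left (b := z)) (sup_le hx.le hz.le) with h | h
  · exact hzx (h ▸ le_sup_right)
  · exact (hj.2 h).elim hx.ne hz.ne

theorem InfIrred.le_of_covBy {m x z : L} (hm : InfIrred m) (hx : m ⋖ x) (hz : m < z) : x ≤ z := by
  by_contra hzx
  rcases hx.eq_or_eq (le_inf hx.le hz.le) (inf_le_left (b := z)) with h | h
  · exact (hm.2 h).elim hx.ne' hz.ne'
  · exact hzx (h ▸ inf_le_right)

variable [Finite L]

theorem SupIrred.lowerStar_covBy {j : L} (hj : SupIrred j) : lowerStar j ⋖ j := by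
  have h : ∃ x, x ⋖ j := by
    obtain ⟨x, hx⟩ := not_isMin_iff.1 hj.1
    obtain ⟨y, -, hy⟩ := exists_le_covBy_of_lt hx
    exact ⟨y, hy⟩
  rw [lowerStar, dif_pos h]
  exact h.choose_spec

theorem InfIrred.covBy_upperStar {m : L} (hm : InfIrred m) : m ⋖ upperStar m := by
  have h : ∃ x, m ⋖ x := by
    obtain ⟨x, hx⟩ := not_isMax_iff.1 hm.1
    obtain ⟨y, hy, -⟩ := exists_covBy_le_of_lt hx
    exact ⟨y, hy⟩
  rw [upperStar, dif_pos h]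
  exact h.choose_spec

/-- Every cover is perspective to the cover below some join-irreducible element. -/
theorem exists_supIrred_con_eq {x y : L} (h : x ⋖ y) :
    ∃ j, SupIrred j ∧ LatticeCon.con (lowerStar j) j = LatticeCon.con x y := by
  obtain ⟨j, ⟨hjy, hjx⟩, hmin⟩ := (Set.toFinite {j : L | j ≤ y ∧ ¬ j ≤ x}).exists_minimal
    ⟨y, le_rfl, fun hyx => h.lt.not_ge hyx⟩
  have hlt : ∀ z, z < j → z ≤ x := fun z hz => by
    by_contra hzx
    exact hz.not_ge (hmin ⟨hz.le.trans hjy, hzx⟩ hz.le)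
  have hj : SupIrred j := by
    refine ⟨fun hm => hjx ((hm inf_le_left).trans inf_le_right), fun b c hbc => ?_⟩
    by_contra hne
    push Not at hne
    refine hjx (hbc ▸ sup_le (hlt b ?_) (hlt c ?_))
    · exact lt_of_le_of_ne (hbc ▸ le_sup_left) hne.1
    · exact lt_of_le_of_ne (hbc ▸ le_sup_right) hne.2
  have hs := hj.lowerStar_covBy
  refine ⟨j, hj, le_antisymm (LatticeCon.con_le_iff.2 ?_) (LatticeCon.con_le_iff.2 ?_)⟩
  · have hr := (LatticeCon.con x y).inf (LatticeCon.con_rel x y) ((LatticeCon.con x y).refl j)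
    have hx : x ⊓ j = lowerStar j := by
      refine le_antisymm (hj.le_of_covBy hs (lt_of_le_of_ne inf_le_right fun he => hjx ?_))
        (le_inf (hlt _ hs.lt) hs.le)
      exact he ▸ inf_le_left
    rwa [hx, inf_eq_right.2 hjy] at hr
  · have hr := (LatticeCon.con (lowerStar j) j).sup (LatticeCon.con_rel (lowerStar j) j)
      ((LatticeCon.con (lowerStar j) j).refl x)
    have hy : j ⊔ x = y := (h.eq_or_eq le_sup_right (sup_le hjy h.le)).resolve_left
      fun he => hjx (he ▸ le_sup_left)
    rwa [hy, sup_eq_right.2 (hlt _ hs.lt)] at hr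

/-- Every cover is perspective to the cover above some meet-irreducible element. -/
theorem exists_infIrred_con_eq {x y : L} (h : x ⋖ y) :
    ∃ m, InfIrred m ∧ LatticeCon.con m (upperStar m) = LatticeCon.con x y := by
  obtain ⟨m, ⟨hxm, hym⟩, hmax⟩ := (Set.toFinite {m : L | x ≤ m ∧ ¬ y ≤ m}).exists_maximal
    ⟨x, le_rfl, fun hyx => h.lt.not_ge hyx⟩
  have hlt : ∀ z, m < z → y ≤ z := fun z hz => by
    by_contra hzx
    exact hz.not_ge (hmax ⟨hxm.trans hz.le, hzx⟩ hz.le)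
  have hm : InfIrred m := by
    refine ⟨fun hm => hym (le_sup_right.trans (hm le_sup_left)), fun b c hbc => ?_⟩
    by_contra hne
    push Not at hne
    refine hym (hbc ▸ le_inf (hlt b ?_) (hlt c ?_))
    · exact lt_of_le_of_ne (hbc ▸ inf_le_left) hne.1.symm
    · exact lt_of_le_of_ne (hbc ▸ inf_le_right) hne.2.symm
  have hs := hm.covBy_upperStar
  refine ⟨m, hm, le_antisymm (LatticeCon.con_le_iff.2 ?_) (LatticeCon.con_le_iff.2 ?_)⟩
  · have hr := (LatticeCon.con x y).sup (LatticeCon.con_rel x y) ((LatticeCon.con x y).refl m)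
    have hy : y ⊔ m = upperStar m := by
      refine le_antisymm (sup_le (hlt _ hs.lt) hs.le)
        (hm.le_of_covBy hs (lt_of_le_of_ne le_sup_right fun he => hym ?_))
      exact he ▸ le_sup_left
    rwa [hy, sup_eq_right.2 hxm] at hr
  · have hr := (LatticeCon.con m (upperStar m)).inf (LatticeCon.con_rel m (upperStar m))
      ((LatticeCon.con m (upperStar m)).refl y)
    have hx : m ⊓ y = x := (h.eq_or_eq (le_inf hxm h.le) inf_le_right).resolve_right
      fun he => hym (he ▸ inf_le_left)
    rwa [hx, inf_eq_right.2 (hlt _ hs.lt)] at hr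

/-- In a finite lattice both maps from the definition of congruence-uniformity are well-defined and
surjective, so it suffices that they are injective. -/
theorem isCongruenceUniform_of_injective [Nonempty L]
    (hsup : ∀ {x y x' y' : L}, x ⋖ y → x' ⋖ y' → SupIrred y → SupIrred y' →
      LatticeCon.con x y = LatticeCon.con x' y' → y = y')
    (hinf : ∀ {x y x' y' : L}, x ⋖ y → x' ⋖ y' → InfIrred x → InfIrred x' →
      LatticeCon.con x y = LatticeCon.con x' y' → x = x') : IsCongruenceUniform L where
  finite := inferInstance
  nonempty := inferInstance
  join_bijOn := by
    refine ⟨fun j hj => LatticeCon.supIrred_con hj.lowerStar_covBy, fun j hj j' hj' he => ?_,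
      fun c hc => ?_⟩
    · exact hsup hj.lowerStar_covBy hj'.lowerStar_covBy hj hj' he
    · obtain ⟨x, y, hxy, rfl⟩ := LatticeCon.exists_covBy_of_supIrred hc
      exact exists_supIrred_con_eq hxy
  meet_bijOn := by
    refine ⟨fun m hm => LatticeCon.supIrred_con hm.covBy_upperStar, fun m hm m' hm' he => ?_,
      fun c hc => ?_⟩
    · exact hinf hm.covBy_upperStar hm'.covBy_upperStar hm hm' he
    · obtain ⟨x, y, hxy, rfl⟩ := LatticeCon.exists_covBy_of_supIrred hc
      exact exists_infIrred_con_eq hxy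

end Stars

section OrderIso

variable {L L' : Type*} [Lattice L] [Lattice L']

theorem OrderIso.map_con_eq (e : L ≃o L') {x y x' y' : L}
    (h : LatticeCon.con x y = LatticeCon.con x' y') :
    LatticeCon.con (e x) (e y) = LatticeCon.con (e x') (e y') := by
  have key : ∀ {x y x' y' : L}, LatticeCon.con x y ≤ LatticeCon.con x' y' →
      LatticeCon.con (e x) (e y) ≤ LatticeCon.con (e x') (e y') := by
    intro x y x' y' h
    let c := LatticeCon.con (e x') (e y')
    let d : LatticeCon L :=
      { r := fun u v => c.r (e u) (e v)
        iseqv := ⟨fun u => c.refl (e u), fun h => c.symm h, fun h h' => c.trans h h'⟩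
        inf := fun h h' => by simpa only [map_inf] using c.inf h h'
        sup := fun h h' => by simpa only [map_sup] using c.sup h h' }
    have hd : d.r x' y' := LatticeCon.con_rel (e x') (e y')
    have hxy : d.r x y := LatticeCon.con_le_iff.1 (h.trans (LatticeCon.con_le_iff.2 hd))
    exact LatticeCon.con_le_iff.2 hxy
  exact le_antisymm (key h.le) (key h.ge)

theorem SupIrred.map_orderIso (e : L ≃o L') {j : L} (hj : SupIrred j) : SupIrred (e j) := by
  refine ⟨fun h => hj.1 fun x hx => e.le_iff_le.1 (h (e.le_iff_le.2 hx)), fun b c hbc => ?_⟩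
  have he : e.symm b ⊔ e.symm c = j := by rw [← map_sup, hbc, e.symm_apply_apply]
  have := hj.2 he
  exact this.imp (fun h => by rw [← h, e.apply_symm_apply]) fun h => by
    rw [← h, e.apply_symm_apply]

theorem InfIrred.map_orderIso (e : L ≃o L') {m : L} (hm : InfIrred m) : InfIrred (e m) := by
  refine ⟨fun h => hm.1 fun x hx => e.le_iff_le.1 (h (e.le_iff_le.2 hx)), fun b c hbc => ?_⟩
  have he : e.symm b ⊓ e.symm c = m := by rw [← map_inf, hbc, e.symm_apply_apply]
  have := hm.2 he
  exact this.imp (fun h => by rw [← h, e.apply_symm_apply]) fun h => by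
    rw [← h, e.apply_symm_apply]

theorem IsCongruenceUniform.of_orderIso (e : L ≃o L') (h : IsCongruenceUniform L') :
    IsCongruenceUniform L := by
  have := h.finite
  have := h.nonempty
  have : Finite L := Finite.of_equiv L' e.symm.toEquiv
  have : Nonempty L := e.symm.toEquiv.nonempty_congr.1 inferInstance
  refine isCongruenceUniform_of_injective ?_ ?_
  · intro x y x' y' hxy hxy' hy hy' hcon
    have key : ∀ {x y : L}, x ⋖ y → SupIrred y → lowerStar (e y) = e x := fun {x y} hxy hy => by
      have hy' := hy.map_orderIso e
      have hs := hy'.lowerStar_covBy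
      have hx : e x ⋖ e y := (apply_covBy_apply_iff e).2 hxy
      exact le_antisymm (hy'.le_of_covBy hx hs.lt) (hy'.le_of_covBy hs hx.lt)
    refine e.injective (h.join_bijOn.injOn (hy.map_orderIso e) (hy'.map_orderIso e) ?_)
    simp only [key hxy hy, key hxy' hy']
    exact e.map_con_eq hcon
  · intro x y x' y' hxy hxy' hx hx' hcon
    have key : ∀ {x y : L}, x ⋖ y → InfIrred x → upperStar (e x) = e y := fun {x y} hxy hx => by
      have hx' := hx.map_orderIso e
      have hs := hx'.covBy_upperStar
      have hy : e x ⋖ e y := (apply_covBy_apply_iff e).2 hxy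
      exact le_antisymm (hx'.le_of_covBy hs hy.lt) (hx'.le_of_covBy hy hs.lt)
    refine e.injective (h.meet_bijOn.injOn (hx.map_orderIso e) (hx'.map_orderIso e) ?_)
    simp only [key hxy hx, key hxy' hx']
    exact e.map_con_eq hcon

end OrderIso

/-! ### The lattice of torsion classes -/

namespace GridTamari

/-- The torsion classes of kind `b`, ordered by inclusion. -/
def TorsionClass (I : ℤ → ℤ → Prop) (b : Bool) : Type :=
  {T : ℤ → ℤ → (ℤ → ℤ) → Prop // IsTorsion I b T}

variable {I : ℤ → ℤ → Prop} {b : Bool}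

theorem IsTorsion.inf {T T' : ℤ → ℤ → (ℤ → ℤ) → Prop} (hT : IsTorsion I b T)
    (hT' : IsTorsion I b T') : IsTorsion I b fun i j f => T i j f ∧ T' i j f where
  seg h := hT.seg h.1
  congr h hfg := ⟨hT.congr h.1 hfg, hT'.congr h.2 hfg⟩
  sub h hp := ⟨hT.sub h.1 hp, hT'.sub h.2 hp⟩
  cat hs h h' := ⟨hT.cat hs h.1 h'.1, hT'.cat hs h.2 h'.2⟩

theorem IsTorsion.sup {T T' : ℤ → ℤ → (ℤ → ℤ) → Prop} (hT : IsTorsion I b T)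
    (hT' : IsTorsion I b T') : IsTorsion I b (Filt I fun i j f => T i j f ∨ T' i j f) :=
  isTorsion_filt (fun h => h.elim hT.seg hT'.seg)
    (fun h hfg => h.imp (hT.congr · hfg) (hT'.congr · hfg))
    (fun h hp => h.imp (hT.sub · hp) (hT'.sub · hp))

/-- The join of two torsion classes consists of all concatenations of their elements. -/
instance : Lattice (TorsionClass I b) where
  le S T := ∀ i j f, S.1 i j f → T.1 i j f
  le_refl _ _ _ _ h := h
  le_trans _ _ _ h h' i j f hf := h' i j f (h i j f hf)
  le_antisymm S T h h' := Subtype.ext <| by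
    funext i j f
    exact propext ⟨h i j f, h' i j f⟩
  inf S T := ⟨fun i j f => S.1 i j f ∧ T.1 i j f, S.2.inf T.2⟩
  inf_le_left _ _ _ _ _ h := h.1
  inf_le_right _ _ _ _ _ h := h.2
  le_inf _ _ _ h h' i j f hf := ⟨h i j f hf, h' i j f hf⟩
  sup S T := ⟨Filt I fun i j f => S.1 i j f ∨ T.1 i j f, S.2.sup T.2⟩
  le_sup_left _ _ _ _ _ h := .base (.inl h)
  le_sup_right _ _ _ _ _ h := .base (.inr h)
  sup_le _ _ U h h' _ _ _ hf := hf.mem_of_subset U.2 fun i j f => Or.rec (h i j f) (h' i j f)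

instance : Nonempty (TorsionClass I b) :=
  ⟨⟨fun _ _ _ => False, False.elim, False.elim, False.elim, fun _ => False.elim⟩⟩

theorem TorsionClass.exists_isLabel {S T : TorsionClass I b} (h : S ⋖ T) :
    ∃ a c s, IsLabel I b S.1 T.1 a c s := by
  refine exists_isLabel_of_generated T.2 S.2 h.le ?_ ?_
  · by_contra hne
    push Not at hne
    exact h.lt.not_ge hne
  · rintro Y hY h1 h2 ⟨i, j, f, h3, h4⟩
    have := h.eq_or_eq (c := ⟨Y, hY⟩) h1 h2
    rcases this with he | he
    · rw [← he] at h4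
      exact (h4 h3).elim
    · rw [← he]
      exact fun _ _ _ h => h

/-- A segment that is torsion-free for two torsion classes is torsion-free for their join. -/
theorem TorsionClass.orth_sup {S T : TorsionClass I b} {i j : ℤ} {f : ℤ → ℤ}
    (h : orth I b S.1 i j f) (h' : orth I b T.1 i j f) : orth I b (S ⊔ T).1 i j f := by
  refine ⟨h.1, fun i' j' hp hf => ?_⟩
  have hU : ∀ i j f, S.1 i j f ∨ T.1 i j f → i ≤ j := fun _ _ _ h =>
    (h.elim S.2.seg T.2.seg).1
  obtain ⟨i'', j'', hp', hu⟩ := Filt.exists_piece hU (!b) hf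
  exact hu.elim (h.2 _ _ (hp.trans hp')) (h'.2 _ _ (hp.trans hp'))

/-- Agreement on a set `R` of segments that is closed under subsegments is a lattice congruence: if
a concatenation lies in `R`, then so do its factors. -/
def restrictCon (I : ℤ → ℤ → Prop) (b : Bool) (R : ℤ → ℤ → (ℤ → ℤ) → Prop)
    (hR : ∀ {i j k f}, i ≤ j → j < k → R i k f → R i j f ∧ R (j + 1) k f) :
    LatticeCon (TorsionClass I b) where
  r S T := ∀ i j f, R i j f → (S.1 i j f ↔ T.1 i j f)
  iseqv := ⟨fun _ _ _ _ _ => Iff.rfl, fun h i j f hf => (h i j f hf).symm,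
    fun h h' i j f hf => (h i j f hf).trans (h' i j f hf)⟩
  inf h h' i j f hf := and_congr (h i j f hf) (h' i j f hf)
  sup := by
    have key : ∀ {S T S' T' : TorsionClass I b}, (∀ i j f, R i j f → (S.1 i j f ↔ T.1 i j f)) →
        (∀ i j f, R i j f → (S'.1 i j f ↔ T'.1 i j f)) →
        ∀ i j f, R i j f → (S ⊔ S').1 i j f → (T ⊔ T').1 i j f := by
      intro S T S' T' h h' i j f hf hm
      change Filt I _ i j f at hm
      induction hm with
      | base hu => exact .base (hu.imp (h _ _ _ hf).1 (h' _ _ _ hf).1)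
      | @cat i j k f hs h1 h2 ih1 ih2 =>
        have hl := ((S ⊔ S').2.seg h1).1
        have hr := ((S ⊔ S').2.seg h2).1
        have := hR hl (by omega) hf
        exact .cat hs (ih1 this.1) (ih2 this.2)
    exact fun {_ _ _ _} h h' i j f hf => ⟨key h h' i j f hf,
      key (fun i j f hf => (h i j f hf).symm) (fun i j f hf => (h' i j f hf).symm) i j f hf⟩

/-- If the cover `S ⋖ T` generates at least the congruence generated by `S' ⋖ T'`, then the label of
`S ⋖ T` is contained in that of `S' ⋖ T'`: agreement on the segments which do not contain the
former is a congruence that identifies `S` and `T`. -/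
theorem IsLabel.contains_of_con_le {S T S' T' : TorsionClass I b} (hST : S ≤ T)
    {a c a' c' : ℤ} {s s' : ℤ → ℤ} (hl : IsLabel I b S.1 T.1 a c s)
    (hl' : IsLabel I b S'.1 T'.1 a' c' s')
    (hcon : LatticeCon.con S' T' ≤ LatticeCon.con S T) :
    a' ≤ a ∧ c ≤ c' ∧ ∀ d, a ≤ d → d ≤ c → s' d = s d := by
  by_contra hne
  let R : ℤ → ℤ → (ℤ → ℤ) → Prop := fun i j f =>
    ¬ (i ≤ a ∧ c ≤ j ∧ ∀ d, a ≤ d → d ≤ c → f d = s d)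
  let C := restrictCon I b R fun {i j k f} h1 h2 h =>
    ⟨fun h' => h ⟨h'.1, by have := h'.2.1; omega, h'.2.2⟩,
      fun h' => h ⟨by have := h'.1; omega, h'.2⟩⟩
  have hC : C.r S T := by
    intro i j f hf
    refine ⟨hST i j f, fun hT => ?_⟩
    by_contra hS
    obtain ⟨i', j', hp, ho, -⟩ := S.2.exists_piece_orth (T.2.seg hT) hS
    obtain ⟨rfl, rfl, hs⟩ := hl.unique (T.2.sub hT hp) ho
    exact hf ⟨hp.1, hp.2.2.1, hs⟩
  have hC' : C.r S' T' := LatticeCon.con_le_iff.1 (hcon.trans (LatticeCon.con_le_iff.2 hC))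
  exact hl'.mem_orth.not_mem ((hC' a' c' s' hne).2 hl'.mem)

theorem IsLabel.eq_of_con_eq {S T S' T' : TorsionClass I b} (h : S ⋖ T) (h' : S' ⋖ T')
    {a c a' c' : ℤ} {s s' : ℤ → ℤ} (hl : IsLabel I b S.1 T.1 a c s)
    (hl' : IsLabel I b S'.1 T'.1 a' c' s')
    (hcon : LatticeCon.con S T = LatticeCon.con S' T') :
    a' = a ∧ c' = c ∧ ∀ d, a ≤ d → d ≤ c → s' d = s d := by
  have k := hl.contains_of_con_le h.le hl' hcon.ge
  have k' := hl'.contains_of_con_le h'.le hl hcon.le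
  exact ⟨by omega, by omega, k.2.2⟩

theorem TorsionClass.isCongruenceUniform [Finite (TorsionClass I b)] :
    IsCongruenceUniform (TorsionClass I b) := by
  refine isCongruenceUniform_of_injective ?_ ?_
  · intro S T S' T' h h' hT hT' hcon
    obtain ⟨a, c, s, hl⟩ := exists_isLabel h
    obtain ⟨a', c', s', hl'⟩ := exists_isLabel h'
    obtain ⟨rfl, rfl, hs⟩ := hl.eq_of_con_eq h h' hl' hcon
    have hmem : (T ⊓ T').1 a' c' s := ⟨hl.mem, T'.2.congr hl'.mem hs⟩
    refine le_antisymm ?_ ?_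
    · by_contra hle
      exact hl.mem_orth.not_mem
        (hT.le_of_covBy h (lt_of_le_of_ne inf_le_left fun he => hle (he ▸ inf_le_right)) _ _ _ hmem)
    · by_contra hle
      refine hl'.mem_orth.not_mem (S'.2.congr (hT'.le_of_covBy h' (lt_of_le_of_ne inf_le_right
        fun he => hle (he ▸ inf_le_left)) _ _ _ hmem) fun d hd hd' => (hs d hd hd').symm)
  · intro S T S' T' h h' hS hS' hcon
    obtain ⟨a, c, s, hl⟩ := exists_isLabel h
    obtain ⟨a', c', s', hl'⟩ := exists_isLabel h'
    obtain ⟨rfl, rfl, hs⟩ := hl.eq_of_con_eq h h' hl' hcon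
    have ho' : orth I b S'.1 a' c' s := S'.2.isTorsion_orth.congr hl'.mem_orth hs
    have ho := orth_sup hl.mem_orth ho'
    refine le_antisymm ?_ ?_
    · by_contra hle
      exact ho.not_mem (hS'.le_of_covBy h' (lt_of_le_of_ne le_sup_right
        fun he => hle (he ▸ le_sup_left)) _ _ _ (T'.2.congr hl'.mem hs))
    · by_contra hle
      exact ho.not_mem (hS.le_of_covBy h (lt_of_le_of_ne le_sup_left
        fun he => hle (he ▸ le_sup_right)) _ _ _ hl.mem)


/-! ### Paths as lists and as functions -/

/-- The vertex of the walk `f` on the diagonal `d`. -/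
def vertex (f : ℤ → ℤ) (d : ℤ) : ℤ × ℤ := (f d, f d - d)

/-- The list of vertices of the walk `f` from the diagonal `i` to the diagonal `j`. -/
def walkList (f : ℤ → ℤ) (i j : ℤ) : List (ℤ × ℤ) :=
  (List.range (j + 1 - i).toNat).map fun k : ℕ => vertex f (i + k)

/-- The interior vertices of the shape, in the coordinates used for walks. -/
def interiorAt (lam : Shape) (x d : ℤ) : Prop := IsInterior lam (x, x - d)

theorem length_walkList (f : ℤ → ℤ) (i j : ℤ) : (walkList f i j).length = (j + 1 - i).toNat := by
  simp [walkList]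

theorem getElem_walkList {f : ℤ → ℤ} {i j : ℤ} {k : ℕ} (h : k < (walkList f i j).length) :
    (walkList f i j)[k] = vertex f (i + k) := by
  simp [walkList]

theorem mem_walkList {f : ℤ → ℤ} {i j : ℤ} {v : ℤ × ℤ} :
    v ∈ walkList f i j ↔ ∃ d, i ≤ d ∧ d ≤ j ∧ vertex f d = v := by
  simp only [walkList, List.mem_map, List.mem_range]
  constructor
  · rintro ⟨k, hk, rfl⟩
    exact ⟨i + k, by omega, by omega, rfl⟩
  · rintro ⟨d, h1, h2, rfl⟩
    exact ⟨(d - i).toNat, by omega, by congr 1; omega⟩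

theorem walkList_append {f : ℤ → ℤ} {i j k : ℤ} (h : i ≤ j + 1) (h' : j ≤ k) :
    walkList f i j ++ walkList f (j + 1) k = walkList f i k := by
  refine List.ext_getElem ?_ fun n h1 h2 => ?_
  · simp only [List.length_append, length_walkList]
    omega
  · rw [List.getElem_append, getElem_walkList]
    simp only [length_walkList]
    split_ifs with hn
    · rw [getElem_walkList]
    · rw [getElem_walkList]
      congr 1
      omega

theorem walkList_self (f : ℤ → ℤ) (i : ℤ) : walkList f i i = [vertex f i] := by
  simp [walkList]

theorem walkList_eq_cons_append {f : ℤ → ℤ} {i j : ℤ} (h : i ≤ j + 1) :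
    walkList f (i - 1) (j + 1) = vertex f (i - 1) :: (walkList f i j ++ [vertex f (j + 1)]) := by
  rw [← walkList_append (j := i - 1) (by omega) (by omega), walkList_self, sub_add_cancel,
    ← walkList_append (j := j) h (by omega), walkList_self]
  rfl

theorem walkList_ne_nil {f : ℤ → ℤ} {i j : ℤ} (h : i ≤ j) : walkList f i j ≠ [] := by
  rw [← List.length_pos_iff, length_walkList]
  omega

theorem head_walkList {f : ℤ → ℤ} {i j : ℤ} (h : walkList f i j ≠ []) :
    (walkList f i j).head h = vertex f i := by
  rw [List.head_eq_getElem, getElem_walkList]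
  simp

theorem getLast_walkList {f : ℤ → ℤ} {i j : ℤ} (h : walkList f i j ≠ []) :
    (walkList f i j).getLast h = vertex f j := by
  rw [List.getLast_eq_getElem, getElem_walkList]
  have := List.length_pos_iff.2 h
  rw [length_walkList] at this ⊢
  congr 1
  omega

theorem vertex_inj {f g : ℤ → ℤ} {d e : ℤ} (h : vertex f d = vertex g e) : d = e ∧ f d = g e := by
  simp only [vertex, Prod.mk.injEq] at h
  omega

theorem walkList_inj {f g : ℤ → ℤ} {i j i' j' : ℤ} (hij : i ≤ j)
    (h : walkList f i j = walkList g i' j') :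
    i = i' ∧ j = j' ∧ ∀ d, i ≤ d → d ≤ j → f d = g d := by
  have hl := congrArg List.length h
  rw [length_walkList, length_walkList] at hl
  have hk : ∀ k : ℕ, k < (j + 1 - i).toNat → vertex f (i + k) = vertex g (i' + k) := by
    intro k hk
    have h1 : k < (walkList f i j).length := by rwa [length_walkList]
    have h2 : k < (walkList g i' j').length := by rwa [length_walkList, ← hl]
    rw [← getElem_walkList h1, ← getElem_walkList h2]
    simp only [h]
  have h0 := (vertex_inj (hk 0 (by omega))).1
  obtain rfl : i = i' := by simpa using h0
  refine ⟨rfl, by omega, fun d h1 h2 => ?_⟩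
  have := (vertex_inj (hk (d - i).toNat (by omega))).2
  rwa [show i + ((d - i).toNat : ℤ) = d by omega] at this

theorem walkList_congr {f g : ℤ → ℤ} {i j : ℤ} (h : ∀ d, i ≤ d → d ≤ j → f d = g d) :
    walkList f i j = walkList g i j := by
  refine List.map_congr_left fun k hk => ?_
  rw [List.mem_range] at hk
  simp only [vertex, h (i + k) (by omega) (by omega)]

theorem infix_walkList_iff {f : ℤ → ℤ} {lo hi : ℤ} {l : List (ℤ × ℤ)} (hl : l ≠ []) :
    l <:+: walkList f lo hi ↔ ∃ i j, lo ≤ i ∧ i ≤ j ∧ j ≤ hi ∧ l = walkList f i j := by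
  have hpos := List.length_pos_iff.2 hl
  constructor
  · rw [List.infix_iff_getElem?]
    rintro ⟨k, hk, h⟩
    rw [length_walkList] at hk
    refine ⟨lo + k, lo + k + l.length - 1, by omega, by omega, by omega,
      List.ext_getElem ?_ fun n h1 h2 => ?_⟩
    · rw [length_walkList]
      omega
    · have := h n h1
      rw [List.getElem?_eq_getElem (by rw [length_walkList]; omega), getElem_walkList,
        Option.some_inj] at this
      rw [getElem_walkList, ← this]
      congr 1
      push_cast
      ring
  · rintro ⟨i, j, h1, h2, h3, rfl⟩
    refine ⟨walkList f lo (i - 1), walkList f (j + 1) hi, ?_⟩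
    conv_lhs => rw [show walkList f i j = walkList f (i - 1 + 1) j by simp]
    rw [walkList_append (by omega) (by omega), walkList_append (by omega) h3]

theorem step_vertex_iff {f : ℤ → ℤ} {d : ℤ} :
    Step (vertex f d) (vertex f (d + 1)) ↔ f (d + 1) = f d ∨ f (d + 1) = f d + 1 := by
  simp only [Step, vertex, south, east, Prod.mk.injEq]
  omega

theorem isChain_walkList_iff {f : ℤ → ℤ} {lo hi : ℤ} : (walkList f lo hi).IsChain Step ↔
    ∀ d, lo ≤ d → d < hi → f (d + 1) = f d ∨ f (d + 1) = f d + 1 := by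
  rw [List.isChain_iff_getElem]
  constructor
  · intro h d h1 h2
    have := h (d - lo).toNat (by rw [length_walkList]; omega)
    rw [getElem_walkList, getElem_walkList] at this
    rw [← step_vertex_iff]
    convert this using 2 <;> push_cast <;> omega
  · intro h k hk
    rw [length_walkList] at hk
    rw [getElem_walkList, getElem_walkList]
    have := step_vertex_iff.2 (h (lo + k) (by omega) (by omega))
    convert this using 2
    push_cast
    ring

theorem exists_eq_walkList {l : List (ℤ × ℤ)} (hl : l ≠ []) (h : l.IsChain Step) :
    ∃ lo hi f, lo ≤ hi ∧ l = walkList f lo hi := by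
  have hpos := List.length_pos_iff.2 hl
  rw [List.isChain_iff_getElem] at h
  let lo : ℤ := l[0].1 - l[0].2
  have hdiag : ∀ k (hk : k < l.length), l[k].1 - l[k].2 = lo + k := by
    intro k hk
    induction k with
    | zero => simp [lo]
    | succ k ih =>
      have := ih (by omega)
      have hs := h k hk
      simp only [Step, south, east, Prod.ext_iff] at hs
      push_cast
      omega
  refine ⟨lo, lo + l.length - 1, fun d => (l.getD (d - lo).toNat 0).1, by omega,
    List.ext_getElem ?_ fun k h1 h2 => ?_⟩
  · rw [length_walkList]
    omega
  · rw [getElem_walkList]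
    have hk : (lo + (k : ℤ) - lo).toNat = k := by omega
    have := hdiag k h1
    simp only [vertex, hk, List.getD_eq_getElem _ _ h1]
    ext
    · rfl
    · simp only
      omega

theorem west_vertex_iff {f : ℤ → ℤ} {i : ℤ} :
    west (vertex f i) = vertex f (i - 1) ↔ f i = f (i - 1) + 1 := by
  simp only [vertex, west, Prod.mk.injEq]
  omega

theorem north_vertex_iff {f : ℤ → ℤ} {i : ℤ} :
    north (vertex f i) = vertex f (i - 1) ↔ f i = f (i - 1) := by
  simp only [vertex, north, Prod.mk.injEq]
  omega

theorem east_vertex_iff {f : ℤ → ℤ} {i : ℤ} :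
    east (vertex f i) = vertex f (i + 1) ↔ f (i + 1) = f i + 1 := by
  simp only [vertex, east, Prod.mk.injEq]
  omega

theorem south_vertex_iff {f : ℤ → ℤ} {i : ℤ} :
    south (vertex f i) = vertex f (i + 1) ↔ f (i + 1) = f i := by
  simp only [vertex, south, Prod.mk.injEq]
  omega

theorem cons_append_infix_walkList {f : ℤ → ℤ} {lo hi : ℤ} {s : List (ℤ × ℤ)} (hs : s ≠ [])
    {u v : ℤ × ℤ} (h : u :: (s ++ [v]) <:+: walkList f lo hi) :
    ∃ i j, lo < i ∧ i ≤ j ∧ j < hi ∧ s = walkList f i j ∧ u = vertex f (i - 1) ∧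
      v = vertex f (j + 1) := by
  obtain ⟨i, j, h1, h2, h3, h4⟩ := (infix_walkList_iff (by simp)).1 h
  have hpos := List.length_pos_iff.2 hs
  have hlen := congrArg List.length h4
  simp only [List.length_cons, List.length_append, length_walkList, List.length_nil] at hlen
  have hij : i + 1 ≤ j - 1 := by omega
  have := walkList_eq_cons_append (f := f) (i := i + 1) (j := j - 1) (by omega)
  rw [add_sub_cancel_right, sub_add_cancel] at this
  rw [this, List.cons.injEq, List.append_eq_append_iff_of_size_eq_right (by simp)] at h4
  refine ⟨i + 1, j - 1, by omega, hij, by omega, h4.2.1, by simpa using h4.1, ?_⟩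
  simpa using h4.2.2

/-- In terms of functions, kissing says that a common segment is an inner segment of the two kinds
of the two walks. -/
theorem exists_kissAlong_iff {f g : ℤ → ℤ} {lo hi lo' hi' : ℤ}
    (hf : ∀ d, lo ≤ d → d < hi → f (d + 1) = f d ∨ f (d + 1) = f d + 1)
    (hg : ∀ d, lo' ≤ d → d < hi' → g (d + 1) = g d ∨ g (d + 1) = g d + 1) :
    (∃ s, KissAlong (walkList f lo hi) (walkList g lo' hi') s) ↔
      ∃ i j, Inner true f lo hi i j ∧ Inner false g lo' hi' i j ∧
        ∀ d, i ≤ d → d ≤ j → f d = g d := by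
  constructor
  · rintro ⟨s, hs, h1, h2⟩
    obtain ⟨i, j, k1, k2, k3, rfl, k5, k6⟩ := cons_append_infix_walkList hs h1
    obtain ⟨i', j', m1, m2, m3, m4, m5, m6⟩ := cons_append_infix_walkList hs h2
    obtain ⟨rfl, rfl, hfg⟩ := walkList_inj k2 m4
    rw [head_walkList] at k5 m5
    rw [getLast_walkList] at k6 m6
    have hv : ∀ d, i ≤ d → d ≤ j → vertex f d = vertex g d := fun d h1 h2 => by
      simp [vertex, hfg d h1 h2]
    rw [hv i le_rfl k2, north_vertex_iff] at m5
    rw [hv j k2 le_rfl, east_vertex_iff] at m6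
    rw [west_vertex_iff] at k5
    rw [south_vertex_iff] at k6
    refine ⟨i, j, ⟨k1, k2, k3, ?_, ?_⟩, ⟨m1, m2, m3, ?_, ?_⟩, hfg⟩ <;>
      simp [eastStep, *]
  · rintro ⟨i, j, ⟨k1, k2, k3, k4, k5⟩, ⟨m1, m2, m3, m4, m5⟩, hfg⟩
    have hv : ∀ d, i ≤ d → d ≤ j → vertex f d = vertex g d := fun d h1 h2 => by
      simp [vertex, hfg d h1 h2]
    refine ⟨walkList f i j, walkList_ne_nil k2, ?_, ?_⟩
    · have h1 := hf (i - 1) (by omega) (by omega)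
      simp only [eastStep, sub_add_cancel, decide_eq_true_eq, Bool.not_true,
        decide_eq_false_iff_not, not_not] at h1 k4 k5
      rw [head_walkList, getLast_walkList, west_vertex_iff.2 (h1.resolve_left k4),
        south_vertex_iff.2 k5, ← walkList_eq_cons_append (by omega),
        infix_walkList_iff (walkList_ne_nil (by omega))]
      exact ⟨_, _, by omega, by omega, by omega, rfl⟩
    · have h1 := hg j (by omega) (by omega)
      simp only [eastStep, sub_add_cancel, decide_eq_true_eq, Bool.not_false,
        decide_eq_false_iff_not, not_not] at h1 m4 m5
      rw [head_walkList, getLast_walkList, hv i le_rfl k2, hv j k2 le_rfl,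
        north_vertex_iff.2 m4, east_vertex_iff.2 (h1.resolve_left m5), walkList_congr hfg,
        ← walkList_eq_cons_append (by omega), infix_walkList_iff (walkList_ne_nil (by omega))]
      exact ⟨_, _, by omega, by omega, by omega, rfl⟩

variable {lam : Shape}

theorem exists_interiorAt_bound (lam : Shape) :
    ∃ D : ℤ, ∀ x d, interiorAt lam x d → -D ≤ d ∧ d ≤ D := by
  obtain ⟨D, hD⟩ := (lam.image fun v => |v.1 - v.2|).exists_le
  refine ⟨D, fun x d h => abs_le.1 ?_⟩
  have hmem := h 0 (by simp) 0 (by simp)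
  simp only [add_zero] at hmem
  have := hD _ (Finset.mem_image_of_mem _ hmem)
  simpa using this

theorem mem_of_isInterior {v w : ℤ × ℤ} (h : IsInterior lam v) (h1 : -1 ≤ w.1 - v.1)
    (h2 : w.1 - v.1 ≤ 1) (h3 : -1 ≤ w.2 - v.2) (h4 : w.2 - v.2 ≤ 1) : w ∈ lam := by
  have := h (w.1 - v.1) ⟨h1, h2⟩ (w.2 - v.2) ⟨h3, h4⟩
  simpa using this

theorem isPath_walkList {lo hi : ℤ} {f : ℤ → ℤ} (h : IsFullWalk (interiorAt lam) lo hi f) :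
    IsPath lam (walkList f lo hi) := by
  obtain ⟨⟨h1, h2, h3⟩, h4, h5⟩ := h
  refine ⟨walkList_ne_nil (by omega), isChain_walkList_iff.2 h3, ?_, ?_, ?_⟩
  · rw [head_walkList]
    refine ⟨mem_of_isInterior (h2 (lo + 1) (by omega) (by omega)) ?_ ?_ ?_ ?_, h4⟩ <;>
      have := h3 lo le_rfl (by omega) <;> simp only [vertex] <;> omega
  · rw [getLast_walkList]
    refine ⟨mem_of_isInterior (h2 (hi - 1) (by omega) (by omega)) ?_ ?_ ?_ ?_, h5⟩ <;>
      have := h3 (hi - 1) (by omega) (by omega) <;> rw [sub_add_cancel] at this <;>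
      simp only [vertex] <;> omega
  · intro v hv
    have := walkList_eq_cons_append (f := f) (i := lo + 1) (j := hi - 1) (by omega)
    rw [add_sub_cancel_right, sub_add_cancel] at this
    rw [this, List.tail_cons, List.dropLast_concat, mem_walkList] at hv
    obtain ⟨d, k1, k2, rfl⟩ := hv
    exact h2 d (by omega) (by omega)

/-- A full walk that makes steps of both kinds is a bent path. -/
theorem exists_bentPath {lo hi : ℤ} {f : ℤ → ℤ} (h : IsFullWalk (interiorAt lam) lo hi f)
    {b : Bool} {i j : ℤ} (hij : Inner b f lo hi i j) :
    ∃ p : BentPath lam, p.1 = walkList f lo hi := by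
  have key : ∀ {e : Bool}, ∃ d, lo ≤ d ∧ d < hi ∧ eastStep f d = e := by
    intro e
    obtain ⟨k1, k2, k3, k4, k5⟩ := hij
    rcases bool_eq_or_eq_not e b with rfl | rfl
    · exact ⟨i - 1, by omega, by omega, k4⟩
    · exact ⟨j, by omega, by omega, k5⟩
  refine ⟨⟨walkList f lo hi, isPath_walkList h, fun hh => ?_, fun hv => ?_⟩, rfl⟩
  · obtain ⟨d, h1, h2, h3⟩ := key (e := false)
    have := hh _ (mem_walkList.2 ⟨d, h1, h2.le, rfl⟩) _
      (mem_walkList.2 ⟨d + 1, by omega, by omega, rfl⟩)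
    simp only [eastStep, decide_eq_false_iff_not, not_not, vertex] at h3 this
    omega
  · obtain ⟨d, h1, h2, h3⟩ := key (e := true)
    have := hv _ (mem_walkList.2 ⟨d, h1, h2.le, rfl⟩) _
      (mem_walkList.2 ⟨d + 1, by omega, by omega, rfl⟩)
    simp only [eastStep, decide_eq_true_eq, vertex] at h3 this
    omega

theorem BentPath.exists_fullWalk (p : BentPath lam) :
    ∃ lo hi f, IsFullWalk (interiorAt lam) lo hi f ∧ p.1 = walkList f lo hi := by
  obtain ⟨p, hp, hhor, hver⟩ := p
  obtain ⟨lo, hi, f, hle, rfl⟩ := exists_eq_walkList hp.ne_nil hp.chain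
  have hc := isChain_walkList_iff.1 hp.chain
  have hlt : lo + 1 < hi := by
    by_contra hlt
    -- a path with at most two vertices is horizontal or vertical
    have hd : ∀ {v}, v ∈ walkList f lo hi → v = vertex f lo ∨ (lo < hi ∧ v = vertex f (lo + 1)) := by
      intro v hv
      obtain ⟨d, h1, h2, rfl⟩ := mem_walkList.1 hv
      rcases h1.eq_or_lt with rfl | h1
      · exact .inl rfl
      · obtain rfl : d = lo + 1 := by omega
        exact .inr ⟨by omega, rfl⟩
    by_cases he : lo < hi → f (lo + 1) = f lo
    · refine hver fun v hv w hw => ?_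
      rcases hd hv with rfl | ⟨h, rfl⟩ <;> rcases hd hw with rfl | ⟨h', rfl⟩ <;>
        simp [vertex, *]
    · push Not at he
      have h1 := (hc lo le_rfl he.1).resolve_left he.2
      refine hhor fun v hv w hw => ?_
      rcases hd hv with rfl | ⟨h, rfl⟩ <;> rcases hd hw with rfl | ⟨h', rfl⟩ <;>
        simp [vertex, h1]
  refine ⟨lo, hi, f, ⟨⟨hlt, fun d h1 h2 => hp.interior _ ?_, hc⟩, ?_, ?_⟩, rfl⟩
  · have := walkList_eq_cons_append (f := f) (i := lo + 1) (j := hi - 1) (by omega)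
    rw [add_sub_cancel_right, sub_add_cancel] at this
    rw [this, List.tail_cons, List.dropLast_concat, mem_walkList]
    exact ⟨d, by omega, by omega, rfl⟩
  · have := hp.head_boundary.2
    rwa [head_walkList] at this
  · have := hp.last_boundary.2
    rwa [getLast_walkList] at this

/-- The diagonal of the first vertex of a bent path. -/
noncomputable def BentPath.lo (p : BentPath lam) : ℤ := p.exists_fullWalk.choose

/-- The diagonal of the last vertex of a bent path. -/
noncomputable def BentPath.hi (p : BentPath lam) : ℤ := p.exists_fullWalk.choose_spec.choose

/-- The function encoding a bent path. -/
noncomputable def BentPath.fn (p : BentPath lam) : ℤ → ℤ :=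
  p.exists_fullWalk.choose_spec.choose_spec.choose

theorem BentPath.isFullWalk (p : BentPath lam) :
    IsFullWalk (interiorAt lam) p.lo p.hi p.fn :=
  p.exists_fullWalk.choose_spec.choose_spec.choose_spec.1

theorem BentPath.eq_walkList (p : BentPath lam) : p.1 = walkList p.fn p.lo p.hi :=
  p.exists_fullWalk.choose_spec.choose_spec.choose_spec.2

theorem BentPath.exists_of_inner {lo hi : ℤ} {f : ℤ → ℤ}
    (h : IsFullWalk (interiorAt lam) lo hi f) {b : Bool} {i j : ℤ} (hij : Inner b f lo hi i j) :
    ∃ p : BentPath lam, p.lo = lo ∧ p.hi = hi ∧ ∀ d, lo ≤ d → d ≤ hi → f d = p.fn d := by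
  obtain ⟨p, hp⟩ := exists_bentPath h hij
  have := walkList_inj (by have := h.1.1; omega) (hp.symm.trans p.eq_walkList)
  exact ⟨p, this.1.symm, this.2.1.symm, this.2.2⟩

theorem BentPath.ext_fn {p q : BentPath lam} (h1 : p.lo = q.lo) (h2 : p.hi = q.hi)
    (h3 : ∀ d, p.lo ≤ d → d ≤ p.hi → p.fn d = q.fn d) : p = q := by
  refine Subtype.ext ?_
  rw [p.eq_walkList, q.eq_walkList, ← h1, ← h2]
  exact walkList_congr h3

theorem BentPath.exists_kissAlong_iff {p q : BentPath lam} : (∃ s, KissAlong p.1 q.1 s) ↔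
    ∃ i j, Inner true p.fn p.lo p.hi i j ∧ Inner false q.fn q.lo q.hi i j ∧
      ∀ d, i ≤ d → d ≤ j → p.fn d = q.fn d := by
  rw [p.eq_walkList, q.eq_walkList]
  exact GridTamari.exists_kissAlong_iff p.isFullWalk.1.2.2 q.isFullWalk.1.2.2

instance : Finite (BentPath lam) := by
  have hnd : ∀ p : BentPath lam, p.1.Nodup := fun p => by
    rw [p.eq_walkList, List.nodup_iff_injective_getElem]
    intro a c hac
    simp only [getElem_walkList] at hac
    have := (vertex_inj hac).1
    exact Fin.ext (by omega)
  have hmem : ∀ p : BentPath lam, ∀ v ∈ p.1, v ∈ lam := fun p v hv => by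
    have hp := isPath_walkList p.isFullWalk
    have hw := p.isFullWalk
    rw [p.eq_walkList, mem_walkList] at hv
    obtain ⟨d, h1, h2, rfl⟩ := hv
    rcases h1.eq_or_lt with rfl | h1
    · simpa only [head_walkList] using hp.head_boundary.1
    rcases h2.eq_or_lt with rfl | h2
    · simpa only [getLast_walkList] using hp.last_boundary.1
    · exact mem_of_isInterior (hw.1.2.1 d h1 h2) (by simp [vertex]) (by simp [vertex])
        (by simp [vertex]) (by simp [vertex])
  have hfin : Finite {l : List lam // l.Nodup} := inferInstance
  refine Finite.of_injective (β := {l : List lam // l.Nodup})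
    (fun p => ⟨p.1.attachWith (· ∈ lam) (hmem p), ?_⟩) fun p q hpq => ?_
  · exact List.Nodup.of_map Subtype.val (by rw [List.attachWith_map_subtype_val]; exact hnd p)
  · have := congrArg (fun l : {l : List lam // l.Nodup} => l.1.map Subtype.val) hpq
    simp only [List.attachWith_map_subtype_val] at this
    exact Subtype.ext this

instance : Finite (Facet lam) := by
  unfold Facet
  infer_instance

/-! ### Facets and torsion classes -/

/-- The torsion classes of segments of the shape. The kind is chosen such that the order of the
facets corresponds to inclusion. -/
abbrev Tors (lam : Shape) : Type := TorsionClass (interiorAt lam) false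

/-- The bent paths that are compatible with the torsion class. -/
def compatiblePaths (T : Tors lam) : Set (BentPath lam) :=
  {p | Compatible false T.1 p.lo p.hi p.fn}

theorem BentPath.inner_of_eq_on {p : BentPath lam} {f : ℤ → ℤ} {b : Bool} {i j : ℤ}
    (h : Inner b f p.lo p.hi i j) (hf : ∀ d, p.lo ≤ d → d ≤ p.hi → f d = p.fn d) :
    Inner b p.fn p.lo p.hi i j :=
  h.congr h.1 h.2.2.1 fun d _ _ => hf d (by have := h.1; omega) (by have := h.2.2.1; omega)

theorem exists_mem_compatiblePaths {T : Tors lam} {lo hi : ℤ} {f s : ℤ → ℤ}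
    (hw : IsFullWalk (interiorAt lam) lo hi f) (h : Compatible false T.1 lo hi f) {e : Bool}
    {a c : ℤ} (hin : Inner e f lo hi a c) (hs : ∀ d, a ≤ d → d ≤ c → f d = s d) :
    ∃ p ∈ compatiblePaths T, Inner e p.fn p.lo p.hi a c ∧ ∀ d, a ≤ d → d ≤ c → p.fn d = s d := by
  obtain ⟨p, rfl, rfl, hf⟩ := BentPath.exists_of_inner hw hin
  refine ⟨p, h.congr T.2 hf, BentPath.inner_of_eq_on hin hf, fun d h1 h2 => ?_⟩
  rw [← hs d h1 h2, hf d (by have := hin.1; omega) (by have := hin.2.2.1; omega)]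

theorem exists_path_of_mem {T : Tors lam} {i j : ℤ} {s : ℤ → ℤ} (h : T.1 i j s) :
    ∃ a c, Piece true s i j a c ∧ ∃ p ∈ compatiblePaths T, Inner false p.fn p.lo p.hi a c ∧
      ∀ d, a ≤ d → d ≤ c → p.fn d = s d := by
  obtain ⟨a, c, hp, lo, hi, f, hw, hc, hin, hs⟩ :=
    exists_compatible_of_mem T.2 (exists_interiorAt_bound lam) h
  exact ⟨a, c, hp, exists_mem_compatiblePaths hw hc hin hs⟩

theorem exists_path_of_not_mem {T : Tors lam} {i j : ℤ} {s : ℤ → ℤ}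
    (hs : IsSegment (interiorAt lam) i j s) (h : ¬ T.1 i j s) :
    ∃ a c, Piece false s i j a c ∧ ∃ p ∈ compatiblePaths T, Inner true p.fn p.lo p.hi a c ∧
      ∀ d, a ≤ d → d ≤ c → p.fn d = s d := by
  obtain ⟨a, c, hp, lo, hi, f, hw, hc, hin, hs⟩ :=
    exists_compatible_of_not_mem T.2 (exists_interiorAt_bound lam) hs h
  exact ⟨a, c, hp, exists_mem_compatiblePaths hw hc hin hs⟩

theorem isFace_iff {F : Set (BentPath lam)} : IsFace lam F ↔ ∀ p ∈ F, ∀ q ∈ F, ∀ i j,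
    Inner true p.fn p.lo p.hi i j → Inner false q.fn q.lo q.hi i j →
      ¬ ∀ d, i ≤ d → d ≤ j → p.fn d = q.fn d := by
  constructor
  · intro h p hp q hq i j h1 h2 h3
    exact h p hp q hq (.inl (BentPath.exists_kissAlong_iff.2 ⟨i, j, h1, h2, h3⟩))
  · rintro h p hp q hq (hk | hk) <;>
      obtain ⟨i, j, h1, h2, h3⟩ := BentPath.exists_kissAlong_iff.1 hk
    · exact h p hp q hq i j h1 h2 h3
    · exact h q hq p hp i j h1 h2 h3

theorem isFace_compatiblePaths (T : Tors lam) : IsFace lam (compatiblePaths T) :=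
  isFace_iff.2 fun _ hp _ hq i j h1 h2 h3 =>
    hp.2 i j h1 (T.2.congr (hq.1 i j h2) fun d hd hd' => (h3 d hd hd').symm)

/-- A path that is not compatible with `T` kisses one of the compatible paths. -/
theorem maximal_compatiblePaths (T : Tors lam) :
    Maximal (IsFace lam) (compatiblePaths T) := by
  refine ⟨isFace_compatiblePaths T, fun S hS hle q hq => ⟨fun i j hin => ?_, fun i j hin ht => ?_⟩⟩
  · by_contra ht
    obtain ⟨a, c, hp, p, hpm, hin', hs⟩ := exists_path_of_not_mem
      (q.isFullWalk.1.isSegment hin.1 hin.2.1 hin.2.2.1) ht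
    exact isFace_iff.1 hS p (hle hpm) q hq a c hin' (hin.piece hp) hs
  · obtain ⟨a, c, hp, p, hpm, hin', hs⟩ := exists_path_of_mem ht
    exact isFace_iff.1 hS q hq p (hle hpm) a c (hin.piece hp) hin'
      fun d hd hd' => (hs d hd hd').symm

/-- The facet of all paths that are compatible with the torsion class. -/
def toFacet (T : Tors lam) : Facet lam := ⟨compatiblePaths T, maximal_compatiblePaths T⟩

theorem toFacet_injective : Function.Injective (toFacet (lam := lam)) := by
  have key : ∀ S T : Tors lam, compatiblePaths S = compatiblePaths T → S ≤ T := by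
    intro S T h i j f hf
    by_contra hf'
    obtain ⟨a, c, hp, p, hpm, hin, hs⟩ := exists_path_of_not_mem (S.2.seg hf) hf'
    rw [← h] at hpm
    exact hpm.2 a c hin (S.2.congr (S.2.sub hf hp) fun d hd hd' => (hs d hd hd').symm)
  intro S T h
  have h' : compatiblePaths S = compatiblePaths T := congrArg Subtype.val h
  exact le_antisymm (key S T h') (key T S h'.symm)

/-- A facet `F` consists of the paths compatible with the class of the segments that have no piece
which is an inner segment, entered from the West and left to the South, of a path in `F`. -/
theorem toFacet_surjective : Function.Surjective (toFacet (lam := lam)) := by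
  intro F
  let U : ℤ → ℤ → (ℤ → ℤ) → Prop := fun i j f => ∃ p ∈ F.1, Inner true p.fn p.lo p.hi i j ∧
    ∀ d, i ≤ d → d ≤ j → p.fn d = f d
  have hseg : ∀ {i j f}, U i j f → IsSegment (interiorAt lam) i j f := by
    rintro i j f ⟨p, -, hin, hf⟩
    exact (p.isFullWalk.1.isSegment hin.1 hin.2.1 hin.2.2.1).congr hf
  have hU : IsTorsion (interiorAt lam) true (Filt (interiorAt lam) U) := by
    refine isTorsion_filt hseg ?_ ?_
    · rintro i j f g ⟨p, hp, hin, hf⟩ hfg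
      exact ⟨p, hp, hin, fun d h1 h2 => (hf d h1 h2).trans (hfg d h1 h2)⟩
    · rintro i j f i' j' ⟨p, hp, hin, hf⟩ hq
      exact ⟨p, hp, hin.piece (hq.congr fun d h1 h2 => (hf d h1 h2).symm),
        fun d h1 h2 => hf d (hq.1.trans h1) (h2.trans hq.2.2.1)⟩
  let T : Tors lam := ⟨orth (interiorAt lam) true (Filt (interiorAt lam) U), hU.isTorsion_orth⟩
  have hle : F.1 ⊆ compatiblePaths T := by
    refine fun p hp => ⟨fun i j hin => ⟨p.isFullWalk.1.isSegment hin.1 hin.2.1 hin.2.2.1,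
      fun i' j' hq hf => ?_⟩, fun i j hin ht => ?_⟩
    · obtain ⟨a, c, hq', r, hr, hin', hs⟩ := hf.exists_piece (fun _ _ _ h => (hseg h).1) false
      exact isFace_iff.1 F.2.1 r hr p hp a c hin' ((hin.piece hq).piece hq') hs
    · exact ht.not_mem (.base ⟨p, hp, hin, fun _ _ _ => rfl⟩)
  exact ⟨T, Subtype.ext (le_antisymm (F.2.2 (isFace_compatiblePaths T) hle) hle)⟩

instance : Finite (Tors lam) := Finite.of_injective toFacet toFacet_injective

/-- Facets correspond to torsion classes. -/
noncomputable def facetEquiv (lam : Shape) : Facet lam ≃ Tors lam :=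
  (Equiv.ofBijective toFacet ⟨toFacet_injective, toFacet_surjective⟩).symm

theorem toFacet_facetEquiv (F : Facet lam) : toFacet (facetEquiv lam F) = F :=
  (Equiv.ofBijective toFacet ⟨toFacet_injective, toFacet_surjective⟩).apply_symm_apply F

/-! ### Covers of torsion classes and flips of facets -/

theorem not_mem_lower_iff {S T : Tors lam} (hST : S ≤ T) {a c : ℤ} {s : ℤ → ℤ}
    (hl : IsLabel (interiorAt lam) false S.1 T.1 a c s) {p : BentPath lam}
    (hp : p ∈ compatiblePaths T) : p ∉ compatiblePaths S ↔
      Inner false p.fn p.lo p.hi a c ∧ ∀ d, a ≤ d → d ≤ c → p.fn d = s d := by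
  constructor
  · intro h
    by_contra hne
    refine h ⟨fun i j hin => ?_, fun i j hin hs => hp.2 i j hin (hST _ _ _ hs)⟩
    by_contra hs
    obtain ⟨i', j', hq, ho, -⟩ := S.2.exists_piece_orth (T.2.seg (hp.1 i j hin)) hs
    obtain ⟨rfl, rfl, hps⟩ := hl.unique (T.2.sub (hp.1 i j hin) hq) ho
    exact hne ⟨hin.piece hq, hps⟩
  · rintro ⟨hin, hs⟩ hpS
    exact hl.mem_orth.not_mem (S.2.congr (hpS.1 a c hin) hs)

theorem not_mem_upper_iff {S T : Tors lam} (hST : S ≤ T) {a c : ℤ} {s : ℤ → ℤ}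
    (hl : IsLabel (interiorAt lam) false S.1 T.1 a c s) {p : BentPath lam}
    (hp : p ∈ compatiblePaths S) : p ∉ compatiblePaths T ↔
      Inner true p.fn p.lo p.hi a c ∧ ∀ d, a ≤ d → d ≤ c → p.fn d = s d := by
  constructor
  · intro h
    by_contra hne
    refine h ⟨fun i j hin => hST _ _ _ (hp.1 i j hin), fun i j hin ht => ?_⟩
    obtain ⟨rfl, rfl, hps⟩ := hl.unique ht (hp.orth_of_inner p.isFullWalk.1 hin)
    exact hne ⟨hin, hps⟩
  · rintro ⟨hin, hs⟩ hpT
    exact hpT.2 a c hin (T.2.congr hl.mem fun d h1 h2 => (hs d h1 h2).symm)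

theorem exists_path_upper {S T : Tors lam} {a c : ℤ} {s : ℤ → ℤ}
    (hl : IsLabel (interiorAt lam) false S.1 T.1 a c s) :
    ∃ p ∈ compatiblePaths T, Inner false p.fn p.lo p.hi a c ∧
      ∀ d, a ≤ d → d ≤ c → p.fn d = s d := by
  obtain ⟨lo, hi, f, hw, hc, hin, hs⟩ :=
    hl.exists_compatible T.2 S.2 (exists_interiorAt_bound lam)
  exact exists_mem_compatiblePaths hw hc hin hs

theorem exists_path_lower {S T : Tors lam} {a c : ℤ} {s : ℤ → ℤ}
    (hl : IsLabel (interiorAt lam) false S.1 T.1 a c s) :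
    ∃ p ∈ compatiblePaths S, Inner true p.fn p.lo p.hi a c ∧
      ∀ d, a ≤ d → d ≤ c → p.fn d = s d := by
  obtain ⟨lo, hi, f, hw, hc, hin, hs⟩ := (hl.dual T.2).exists_compatible S.2.isTorsion_orth
    T.2.isTorsion_orth (exists_interiorAt_bound lam)
  exact exists_mem_compatiblePaths hw (hc.of_dual S.2 hw.1) hin hs

/-- The facets of a cover of torsion classes differ by one path each, and the two paths kiss along
the label of the cover. -/
theorem dualEdge_of_covBy {S T : Tors lam} (h : S ⋖ T) : DualEdge (toFacet S) (toFacet T) := by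
  obtain ⟨a, c, s, hl⟩ := TorsionClass.exists_isLabel h
  obtain ⟨p, hp, hpin, hps⟩ := exists_path_lower hl
  obtain ⟨q, hq, hqin, hqs⟩ := exists_path_upper hl
  refine ⟨p, q, Set.eq_singleton_iff_unique_mem.2 ⟨⟨hp, ?_⟩, fun r hr => ?_⟩,
    Set.eq_singleton_iff_unique_mem.2 ⟨⟨hq, ?_⟩, fun r hr => ?_⟩,
    BentPath.exists_kissAlong_iff.2 ⟨a, c, hpin, hqin, fun d h1 h2 =>
      (hps d h1 h2).trans (hqs d h1 h2).symm⟩⟩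
  · exact (not_mem_upper_iff h.le hl hp).2 ⟨hpin, hps⟩
  · have hrS : r ∈ compatiblePaths S := hr.1
    obtain ⟨hrin, hrs⟩ := (not_mem_upper_iff h.le hl hrS).1 hr.2
    obtain ⟨h1, h2, h3⟩ := (hl.dual T.2).eq_of_inner S.2.isTorsion_orth T.2.isTorsion_orth
      (fun _ _ _ ho => ho.anti h.le) r.isFullWalk p.isFullWalk (hrS.dual r.isFullWalk.1)
      (Compatible.dual p.isFullWalk.1 hp) hrin hpin hrs hps
    exact BentPath.ext_fn h1 h2 h3
  · exact (not_mem_lower_iff h.le hl hq).2 ⟨hqin, hqs⟩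
  · have hrT : r ∈ compatiblePaths T := hr.1
    obtain ⟨hrin, hrs⟩ := (not_mem_lower_iff h.le hl hrT).1 hr.2
    obtain ⟨h1, h2, h3⟩ := hl.eq_of_inner T.2 S.2 h.le r.isFullWalk q.isFullWalk hrT hq hrin hqin
      hrs hqs
    exact BentPath.ext_fn h1 h2 h3

/-- If the torsion classes of two adjacent facets were incomparable, then the path `p` which only
belongs to the first one would be exchanged both in a cover below and in a cover above the first
torsion class, as the other paths are compatible with both torsion classes, hence with all torsion
classes between their meet and their join. -/
theorem le_of_dualEdge {S T : Tors lam} (h : DualEdge (toFacet S) (toFacet T)) : S ≤ T := by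
  obtain ⟨p, q, hp, hq, hk⟩ := h
  by_contra hST
  have hpS : p ∈ compatiblePaths S := (hp.ge (Set.mem_singleton p)).1
  have hqT : q ∈ compatiblePaths T := (hq.ge (Set.mem_singleton q)).1
  have huniq : ∀ r ∈ compatiblePaths S, r ∉ compatiblePaths T → r = p :=
    fun r h1 h2 => hp.le ⟨h1, h2⟩
  obtain ⟨i, j, hin, hin', hpq⟩ := BentPath.exists_kissAlong_iff.1 hk
  have hTS : ¬ T ≤ S := fun hle => hpS.2 i j hin
    (hle _ _ _ (T.2.congr (hqT.1 i j hin') fun d h1 h2 => (hpq d h1 h2).symm))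
  obtain ⟨S₁, hS₁, hcov₁⟩ := exists_le_covBy_of_lt
    (lt_of_le_of_ne (inf_le_left (a := S) (b := T)) fun he => hST (he ▸ inf_le_right))
  obtain ⟨S₂, hcov₂, hS₂⟩ := exists_covBy_le_of_lt
    (lt_of_le_of_ne (le_sup_left (a := S) (b := T)) fun he => hTS (he ▸ le_sup_right))
  obtain ⟨a₁, c₁, s₁, hl₁⟩ := TorsionClass.exists_isLabel hcov₁
  obtain ⟨a₂, c₂, s₂, hl₂⟩ := TorsionClass.exists_isLabel hcov₂
  obtain ⟨p₁, hp₁, hin₁, hs₁⟩ := exists_path_upper hl₁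
  obtain ⟨p₂, hp₂, hin₂, hs₂⟩ := exists_path_lower hl₂
  obtain rfl : p₁ = p := huniq p₁ hp₁ fun hT =>
    (not_mem_lower_iff hcov₁.le hl₁ hp₁).2 ⟨hin₁, hs₁⟩
      ⟨fun i j hi => hS₁ _ _ _ ⟨hp₁.1 i j hi, hT.1 i j hi⟩,
        fun i j hi hf => hp₁.2 i j hi (hcov₁.le _ _ _ hf)⟩
  obtain rfl : p₂ = p₁ := huniq p₂ hp₂ fun hT =>
    (not_mem_upper_iff hcov₂.le hl₂ hp₂).2 ⟨hin₂, hs₂⟩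
      ⟨fun i j hi => hcov₂.le _ _ _ (hp₂.1 i j hi), fun i j hi hf =>
        (TorsionClass.orth_sup (hp₂.orth_of_inner p₂.isFullWalk.1 hi)
          (hT.orth_of_inner p₂.isFullWalk.1 hi)).not_mem (hS₂ _ _ _ hf)⟩
  exact hl₁.not_inner_inner S₁.2 S.2 S₂.2 hcov₁.le hcov₂.le (exists_interiorAt_bound lam) hl₂
    p₂.isFullWalk hp₂ hin₁ hin₂ hs₁ hs₂

theorem facetEquiv_le_iff {F G : Facet lam} :
    facetEquiv lam F ≤ facetEquiv lam G ↔ GTLe F G := by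
  constructor
  · intro h
    classical
    have := Fintype.ofFinite (Tors lam)
    let _ : LocallyFiniteOrder (Tors lam) := Fintype.toLocallyFiniteOrder
    have := Relation.ReflTransGen.lift (p := DualEdge) toFacet (fun _ _ => dualEdge_of_covBy)
      _ _ (le_iff_reflTransGen_covBy.1 h)
    rwa [Function.onFun, toFacet_facetEquiv, toFacet_facetEquiv] at this
  · intro h
    induction h with
    | refl => exact le_rfl
    | tail _ h ih =>
      refine ih.trans (le_of_dualEdge ?_)
      rwa [toFacet_facetEquiv, toFacet_facetEquiv]

/-- The lattice structure on the facets which comes from the inclusion of torsion classes. -/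
noncomputable abbrev facetLattice (lam : Shape) : Lattice (Facet lam) where
  __ := PartialOrder.lift (facetEquiv lam) (facetEquiv lam).injective
  inf F G := (facetEquiv lam).symm (facetEquiv lam F ⊓ facetEquiv lam G)
  inf_le_left F G := by
    change facetEquiv lam _ ≤ facetEquiv lam _
    simp
  inf_le_right F G := by
    change facetEquiv lam _ ≤ facetEquiv lam _
    simp
  le_inf F G H h h' := by
    change facetEquiv lam _ ≤ facetEquiv lam _
    rw [Equiv.apply_symm_apply]
    exact le_inf h h'
  sup F G := (facetEquiv lam).symm (facetEquiv lam F ⊔ facetEquiv lam G)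
  le_sup_left F G := by
    change facetEquiv lam _ ≤ facetEquiv lam _
    simp
  le_sup_right F G := by
    change facetEquiv lam _ ≤ facetEquiv lam _
    simp
  sup_le F G H h h' := by
    change facetEquiv lam _ ≤ facetEquiv lam _
    rw [Equiv.apply_symm_apply]
    exact sup_le h h'

end GridTamari

theorem theorem1p1 (lam : GridTamari.Shape) :
    ∃ _L : Lattice (GridTamari.Facet lam),
      (∀ F G : GridTamari.Facet lam, F ≤ G ↔ GridTamari.GTLe F G) ∧
        IsCongruenceUniform (GridTamari.Facet lam) := by
  refine ⟨GridTamari.facetLattice lam, fun F G => GridTamari.facetEquiv_le_iff, ?_⟩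
  let _ := GridTamari.facetLattice lam
  let e : GridTamari.Facet lam ≃o GridTamari.Tors lam :=
    { GridTamari.facetEquiv lam with map_rel_iff' := Iff.rfl }
  exact IsCongruenceUniform.of_orderIso e GridTamari.TorsionClass.isCongruenceUniform
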